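/- Fix an integer $d\ge 1$ and integers $q_1,\dots,q_d\ge 2$, and write $\mathbf q=(q_1,\dots,q_d)$. Consider the grid graph on $[n]^d$, where $[n]=\{1,\dots,n\}$ and two vertices are adjacent along coordinate $i$ if they differ by exactly $1$ in coordinate $i$ and agree in all the others. A configuration of $k$ pebbles is a multiset of $k$ vertices. A $\mathbf q$-pebbling step removes $q_i$ pebbles from a vertex and places one pebble on a vertex adjacent to it along coordinate $i$, for some $i$. A configuration is solvable if for every vertex $v$ some finite sequence of steps leads to a configuration with at least one pebble on $v$. Let $p_n(k)$ be the probability that a configuration chosen uniformly at random among all $\binom{n^d+k-1}{k}$ configurations of $k$ pebbles on $[n]^d$ is solvable, and let $P_{1/2}([n]^d)=\min\{k : p_n(k)\ge \tfrac12\}$. Then, for $n\ge 2$, $$P_{1/2}([n]^d)=n^d\exp\left(\left(\frac{(d+1)!\,\log n\,\prod_{i=1}^d\log q_i}{2}\right)^{\frac1{d+1}}-\frac{d\log\log n}{d+1}+O(1)\right),$$ where the $O(1)$ term is bounded as $n\to\infty$ with $d$ and $\mathbf q$ fixed. Moreover $P_{1/2}([n]^d)$ is a weak threshold for solvability: for every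 sequence $k=k(n)$ of non-negative integers, $p_n(k(n))\to 0$ if $k(n)=o(P_{1/2}([n]^d))$, and $p_n(k(n))\to 1$ if $P_{1/2}([n]^d)=o(k(n))$. -/

import Mathlib

open Filter Asymptotics

namespace Pebbling

/-- The vertex set `[n]^d` of the `d`-dimensional grid `P_n × ⋯ × P_n`
(coordinates run through `0, …, n - 1`). -/
abbrev Grid (d n : ℕ) : Type := Fin d → Fin n

/-- A configuration of unlabelled pebbles on `V`: a multiset of vertices, given by its
multiplicity function (`D v` is the number of pebbles on `v`). -/
abbrev Config (V : Type*) : Type _ := V → ℕ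

/-- `x` and `y` are adjacent in the grid along the `i`-th coordinate. -/
def AdjAlong {d n : ℕ} (i : Fin d) (x y : Grid d n) : Prop :=
  (SimpleGraph.pathGraph n).Adj (x i) (y i) ∧ ∀ j, j ≠ i → x j = y j

/-- One `q`-pebbling step: for some coordinate `i` and some `x`, `y` adjacent along the `i`-th
coordinate, `q i` pebbles are removed from `x` and one pebble is placed on `y`. -/
def Step {d n : ℕ} (q : Fin d → ℕ) (D D' : Config (Grid d n)) : Prop :=
  ∃ (i : Fin d) (x y : Grid d n), AdjAlong i x y ∧ q i ≤ D x ∧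
    D' = D - Pi.single x (q i) + Pi.single y 1

/-- `D` is `v`-solvable: a finite sequence of pebbling steps leads from `D` to a configuration
with at least one pebble on `v`. -/
def SolvableAt {d n : ℕ} (q : Fin d → ℕ) (D : Config (Grid d n)) (v : Grid d n) : Prop :=
  ∃ D' : Config (Grid d n), Relation.ReflTransGen (Step q) D D' ∧ 1 ≤ D' v

/-- `D` is solvable if it is `v`-solvable for every vertex `v`. -/
def Solvable {d n : ℕ} (q : Fin d → ℕ) (D : Config (Grid d n)) : Prop :=
  ∀ v, SolvableAt q D v

/-- The finite set of all configurations of exactly `k` pebbles on `[n]^d`. -/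
def configs (d n k : ℕ) : Finset (Config (Grid d n)) :=
  Finset.piAntidiag Finset.univ k

open Classical in
/-- The probability that a uniformly random configuration of `k` unlabelled pebbles on `[n]^d`
is solvable under `q`-pebbling. -/
noncomputable def solvableProb {d : ℕ} (q : Fin d → ℕ) (n k : ℕ) : ℝ :=
  (((configs d n k).filter fun D => Solvable q D).card : ℝ) / ((configs d n k).card : ℝ)

/-- `P_{1/2}([n]^d)`: the least number of pebbles for which a uniformly random configuration is
solvable with probability at least `1/2`. -/
noncomputable def halfThreshold {d : ℕ} (q : Fin d → ℕ) (n : ℕ) : ℕ :=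
  sInf {k : ℕ | (1 / 2 : ℝ) ≤ solvableProb q n k}

/-- `f` is a weak threshold for solvability of `q`-pebbling on the sequence of grids `[n]^d`:
the solvability probability tends to `0` with `k = o(f)` pebbles and to `1` with
`k` pebbles when `f = o(k)`. -/
def IsWeakThreshold {d : ℕ} (q : Fin d → ℕ) (f : ℕ → ℝ) : Prop :=
  ∀ k : ℕ → ℕ,
    ((fun n => (k n : ℝ)) =o[atTop] f →
      Tendsto (fun n => solvableProb q n (k n)) atTop (nhds 0)) ∧
    (f =o[atTop] (fun n => (k n : ℝ)) →
      Tendsto (fun n => solvableProb q n (k n)) atTop (nhds 1))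

end Pebbling

/-!
Write `ℓ i = log (q i)`, let `gridDist ℓ v w = ∑ i, ℓ i * |v i - w i|`, and let the weight of a
configuration `D` seen from `v` be `∑ w, D w * exp (-gridDist ℓ v w)`. No step increases this
weight and a pebble on `v` has weight `1`, so a weight below `1` excludes `v`-solvability
(`one_le_weight_of_solvableAt`). Conversely, steps towards `v` preserve the weight, and a
configuration with no such step left has a bounded number of pebbles off `v`, so a weight above a
constant forces `v`-solvability (`solvableAt_of_weightBound_lt`). The question is therefore when
all the weights are at least of constant order.

Under the uniform distribution on configurations of `k` pebbles, the numbers of pebbles on a small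
set of vertices behave like independent geometric variables of mean `lam = k / n ^ d`. The weight
seen from `v` is small only if each vertex `w` near `v` has fewer than about
`exp (gridDist ℓ v w)` pebbles, up to a polynomial factor absorbed below. This has probability
about `exp (-∑ w, max (M - gridDist ℓ v w) 0)`, where `exp M` is `lam` times that factor. The sum
over one orthant is `M ^ (d + 1) / ((d + 1)! * ∏ i, ℓ i)`, up to an error of order `M ^ d`
(`le_sum_truncPow`, `sum_truncPow_le`), and a vertex with `j` coordinates away from the ends of
`[n]` sees `2 ^ j` orthants. There are about `n ^ j` such vertices. If `L = radius ℓ n` is the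
value of `M` for which an orthant contributes `log n / 2`, the expected number of unsolvable
vertices of this kind is about `n ^ (j - 2 ^ (j - 1))` for `M = L`. Here `2 ^ (j - 1) ≥ j` always,
with equality for `j = 1`, so the vertices on the edges of the grid are already critical.
Replacing `L` by `L ± K` for a constant `K` changes the exponent by a multiple of `K * L ^ d`,
which beats every error term, and the natural normalisation `lam = exp M / M ^ d` comes from the
ball of about `L ^ d` vertices that contribute to the weight. So the threshold is
`n ^ d * exp L / L ^ d` up to constant factors (`density`), and taking logarithms gives the
formula.

The upper bound (`exists_solvableProb_ge`) is a union bound over all vertices, with Chernoff's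
bound at the parameter `L ^ d` for each of them (`card_weight_le`). The lower bound
(`exists_solvableProb_le`) is the second moment method for about `n / L` points of one edge whose
balls of radius `4 * L` are disjoint: for each of these points all vertices `w` in its ball have
at most `cutoff` many pebbles with probability at least `exp L / n` (`le_card_cutoff_edgePoint`),
these events are almost independent (`multichoose_sub_almost_indep`), and the pebbles outside the
ball are negligible because no vertex holds many more pebbles than the average
(`card_exists_ge_le`). Both bounds hold with probability errors tending to `0`, so they give the
order of magnitude of the threshold and its being a weak threshold at once.
-/


/-! ### Weights of configurations -/

namespace Pebbling

/-- The distance on the grid in which a step along the `i`-th coordinate has length `ℓ i`.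
It is used with `ℓ i = log (q i)`, so that `exp (-gridDist ℓ v w)` is the product of the
`q i` along a shortest path from `w` to `v`, inverted. -/
noncomputable def gridDist {d n : ℕ} (ℓ : Fin d → ℝ) (v w : Grid d n) : ℝ :=
  ∑ i, ℓ i * |((v i : ℕ) : ℝ) - ((w i : ℕ) : ℝ)|

/-- The lengths `log (q i)` of the steps along the coordinates. -/
noncomputable def logs {d : ℕ} (q : Fin d → ℕ) (i : Fin d) : ℝ := Real.log (q i)

/-- The weight of the configuration `D` seen from `v`: a pebble on `w` counts
`exp (-gridDist ℓ v w)`. -/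
noncomputable def weight {d n : ℕ} (ℓ : Fin d → ℝ) (v : Grid d n) (D : Config (Grid d n)) : ℝ :=
  ∑ w, (D w : ℝ) * Real.exp (-gridDist ℓ v w)

section GridDist

variable {d n : ℕ} {ℓ : Fin d → ℝ}

lemma gridDist_self (v : Grid d n) : gridDist ℓ v v = 0 := by simp [gridDist]

lemma gridDist_comm (v w : Grid d n) : gridDist ℓ v w = gridDist ℓ w v := by
  simp only [gridDist, abs_sub_comm]

lemma gridDist_nonneg (hℓ : ∀ i, 0 ≤ ℓ i) (v w : Grid d n) : 0 ≤ gridDist ℓ v w :=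
  Finset.sum_nonneg fun i _ => mul_nonneg (hℓ i) (abs_nonneg _)

lemma gridDist_triangle (hℓ : ∀ i, 0 ≤ ℓ i) (u v w : Grid d n) :
    gridDist ℓ u w ≤ gridDist ℓ u v + gridDist ℓ v w := by
  rw [gridDist, gridDist, gridDist, ← Finset.sum_add_distrib]
  refine Finset.sum_le_sum fun i _ => ?_
  rw [← mul_add]
  exact mul_le_mul_of_nonneg_left (abs_sub_le _ _ _) (hℓ i)

lemma mul_abs_le_gridDist (hℓ : ∀ i, 0 ≤ ℓ i) (v w : Grid d n) (i : Fin d) :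
    ℓ i * |((v i : ℕ) : ℝ) - ((w i : ℕ) : ℝ)| ≤ gridDist ℓ v w :=
  Finset.single_le_sum (f := fun i => ℓ i * |((v i : ℕ) : ℝ) - ((w i : ℕ) : ℝ)|)
    (fun i _ => mul_nonneg (hℓ i) (abs_nonneg _)) (Finset.mem_univ i)

lemma gridDist_sub_of_agree {i : Fin d} {x y : Grid d n} (h : ∀ j, j ≠ i → x j = y j)
    (v : Grid d n) :
    gridDist ℓ v x - gridDist ℓ v y =
      ℓ i * (|((v i : ℕ) : ℝ) - ((x i : ℕ) : ℝ)| - |((v i : ℕ) : ℝ) - ((y i : ℕ) : ℝ)|) := by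
  rw [gridDist, gridDist, ← Finset.sum_sub_distrib, Finset.sum_eq_single i]
  · ring
  · intro j _ hj
    rw [h j hj, sub_self]
  · simp

lemma gridDist_le_of_adjAlong (hℓ : ∀ i, 0 ≤ ℓ i) {i : Fin d} {x y : Grid d n}
    (h : AdjAlong i x y) (v : Grid d n) : gridDist ℓ v x ≤ gridDist ℓ v y + ℓ i := by
  have h1 := gridDist_sub_of_agree (ℓ := ℓ) h.2 v
  have h2 : |((v i : ℕ) : ℝ) - ((x i : ℕ) : ℝ)| - |((v i : ℕ) : ℝ) - ((y i : ℕ) : ℝ)| ≤ 1 := by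
    have h3 := abs_sub_le ((v i : ℕ) : ℝ) ((y i : ℕ) : ℝ) ((x i : ℕ) : ℝ)
    have h4 : |((y i : ℕ) : ℝ) - ((x i : ℕ) : ℝ)| = 1 := by
      rcases SimpleGraph.pathGraph_adj.1 h.1 with h | h <;> rw [← h] <;> push_cast <;> simp
    linarith
  have := mul_le_mul_of_nonneg_left h2 (hℓ i)
  linarith

/-- From every `x ≠ v` there is a step that approaches `v`. -/
lemma exists_adjAlong_approach {v x : Grid d n} (h : x ≠ v) :
    ∃ (i : Fin d) (y : Grid d n), AdjAlong i x y ∧ gridDist ℓ v x = gridDist ℓ v y + ℓ i := by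
  obtain ⟨i, hi⟩ := Function.ne_iff.1 h
  have hi' : (x i : ℕ) ≠ v i := fun h => hi (Fin.ext h)
  rcases lt_or_gt_of_ne hi' with hlt | hlt
  · set y : Grid d n := Function.update x i ⟨x i + 1, by omega⟩ with hy
    have hyi : (y i : ℕ) = x i + 1 := by simp [hy]
    have hag : ∀ j, j ≠ i → x j = y j := fun j hj => by simp [hy, hj]
    refine ⟨i, y, ⟨SimpleGraph.pathGraph_adj.2 (Or.inl hyi.symm), hag⟩, ?_⟩
    have h1 := gridDist_sub_of_agree (ℓ := ℓ) hag v
    rw [hyi] at h1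
    have h2 : ((x i : ℕ) : ℝ) + 1 ≤ (v i : ℕ) := by exact_mod_cast hlt
    push_cast at h1
    rw [abs_of_nonneg (by linarith), abs_of_nonneg (by linarith)] at h1
    linarith
  · set y : Grid d n := Function.update x i ⟨x i - 1, by omega⟩ with hy
    have hyi : (y i : ℕ) + 1 = x i := by simp [hy]; omega
    have hag : ∀ j, j ≠ i → x j = y j := fun j hj => by simp [hy, hj]
    refine ⟨i, y, ⟨SimpleGraph.pathGraph_adj.2 (Or.inr hyi), hag⟩, ?_⟩
    have h1 := gridDist_sub_of_agree (ℓ := ℓ) hag v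
    have h2 : ((y i : ℕ) : ℝ) + 1 = (x i : ℕ) := by exact_mod_cast hyi
    have h3 : ((v i : ℕ) : ℝ) + 1 ≤ (x i : ℕ) := by exact_mod_cast hlt
    rw [abs_of_nonpos (by linarith), abs_of_nonpos (by linarith)] at h1
    linear_combination h1 - ℓ i * h2

lemma sum_abs_sub_eq (G : ℝ → ℝ) (a : Fin n) :
    ∑ x : Fin n, G |((a : ℕ) : ℝ) - ((x : ℕ) : ℝ)| =
      ∑ j ∈ Finset.range a, G ((j : ℝ) + 1) + ∑ j ∈ Finset.range (n - a), G j := by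
  rw [Fin.sum_univ_eq_sum_range (fun x : ℕ => G |((a : ℕ) : ℝ) - (x : ℝ)|) n]
  obtain ⟨b, hb⟩ := Nat.exists_eq_add_of_le a.isLt.le
  have h : n - (a : ℕ) = b := by omega
  rw [h]
  rw [show Finset.range n = Finset.range ((a : ℕ) + b) from congrArg _ hb, Finset.sum_range_add,
    ← Finset.sum_range_reflect (fun j : ℕ => G ((j : ℝ) + 1))]
  congr 1
  · refine Finset.sum_congr rfl fun x hx => ?_
    have hx := Finset.mem_range.1 hx
    have e : ((a : ℕ) - 1 - x) + 1 + x = (a : ℕ) := by omega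
    have e' : ((((a : ℕ) - 1 - x : ℕ) : ℝ) + 1) + x = (a : ℕ) := by exact_mod_cast e
    rw [abs_of_nonneg (by linarith [Nat.cast_nonneg (α := ℝ) ((a : ℕ) - 1 - x)])]
    congr 1
    linarith
  · refine Finset.sum_congr rfl fun x _ => ?_
    push_cast
    rw [show ((a : ℕ) : ℝ) - ((a : ℕ) + (x : ℝ)) = -x by ring, abs_neg, Nat.abs_cast]

/-- The exponential sums over the grid are bounded independently of its size. -/
lemma sum_exp_gridDist_le (hℓ : ∀ i, Real.log 2 ≤ ℓ i) (v : Grid d n) :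
    ∑ w, Real.exp (-(gridDist ℓ v w / 2)) ≤ 8 ^ d := by
  have h1 : ∀ w : Grid d n, Real.exp (-(gridDist ℓ v w / 2)) =
      ∏ i, Real.exp (-(ℓ i * |((v i : ℕ) : ℝ) - ((w i : ℕ) : ℝ)| / 2)) := by
    intro w
    rw [← Real.exp_sum, gridDist, Finset.sum_div, ← Finset.sum_neg_distrib]
  simp_rw [h1]
  have h2 := Finset.prod_univ_sum (fun _ : Fin d => (Finset.univ : Finset (Fin n)))
    (fun i x => Real.exp (-(ℓ i * |((v i : ℕ) : ℝ) - ((x : ℕ) : ℝ)| / 2)))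
  rw [Fintype.piFinset_univ] at h2
  rw [← h2]
  calc _ ≤ ∏ _i : Fin d, (8 : ℝ) := by
        refine Finset.prod_le_prod (fun i _ => Finset.sum_nonneg fun _ _ => (Real.exp_pos _).le)
          fun i _ => ?_
        rw [sum_abs_sub_eq fun y => Real.exp (-(ℓ i * y / 2))]
        have hb : Real.exp (-(ℓ i / 2)) ≤ 3 / 4 := by
          refine (Real.exp_le_exp.2
            (show -(ℓ i / 2) ≤ -(Real.log 2 / 2) by linarith [hℓ i])).trans ?_
          have h : Real.exp (-(Real.log 2 / 2)) ^ 2 = 1 / 2 := by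
            rw [← Real.exp_nat_mul]
            have : ((2 : ℕ) : ℝ) * (-(Real.log 2 / 2)) = -Real.log 2 := by push_cast; ring
            rw [this, Real.exp_neg, Real.exp_log (by norm_num)]
            norm_num
          nlinarith [Real.exp_pos (-(Real.log 2 / 2))]
        have hp : ∀ j : ℕ, Real.exp (-(ℓ i * j / 2)) ≤ (3 / 4) ^ j := by
          intro j
          refine le_trans (le_of_eq ?_) (pow_le_pow_left₀ (Real.exp_pos _).le hb j)
          rw [← Real.exp_nat_mul]
          congr 1
          ring
        have key : ∀ N : ℕ, ∑ j ∈ Finset.range N, (3 / 4 : ℝ) ^ j ≤ 4 := by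
          intro N
          have := geom_sum_mul_neg (3 / 4 : ℝ) N
          have := pow_nonneg (show (0 : ℝ) ≤ 3 / 4 by norm_num) N
          linarith
        have h1 : ∑ j ∈ Finset.range (v i : ℕ), Real.exp (-(ℓ i * ((j : ℝ) + 1) / 2)) ≤ 4 := by
          refine le_trans (Finset.sum_le_sum fun j _ => le_trans ?_ (hp j)) (key _)
          have := (Real.log_pos (by norm_num : (1 : ℝ) < 2)).trans_le (hℓ i)
          exact Real.exp_le_exp.2 (by linarith)
        have h2 : ∑ j ∈ Finset.range (n - (v i : ℕ)), Real.exp (-(ℓ i * (j : ℝ) / 2)) ≤ 4 :=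
          le_trans (Finset.sum_le_sum fun j _ => hp j) (key _)
        linarith
    _ = 8 ^ d := by simp

end GridDist

section Solvability

variable {d n : ℕ} {q : Fin d → ℕ}

lemma log_two_le_logs (hq : ∀ i, 2 ≤ q i) (i : Fin d) : Real.log 2 ≤ logs q i :=
  Real.log_le_log (by norm_num) (by exact_mod_cast hq i)

lemma logs_pos (hq : ∀ i, 2 ≤ q i) (i : Fin d) : 0 < logs q i :=
  (Real.log_pos (by norm_num)).trans_le (log_two_le_logs hq i)

lemma exp_logs (hq : ∀ i, 2 ≤ q i) (i : Fin d) : Real.exp (logs q i) = q i :=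
  Real.exp_log (by have := hq i; positivity)

lemma le_weight (ℓ : Fin d → ℝ) (v : Grid d n) (D : Config (Grid d n)) :
    (D v : ℝ) ≤ weight ℓ v D := by
  have := Finset.single_le_sum (f := fun w => (D w : ℝ) * Real.exp (-gridDist ℓ v w))
    (fun _ _ => mul_nonneg (Nat.cast_nonneg _) (Real.exp_pos _).le) (Finset.mem_univ v)
  simpa [gridDist_self, weight] using this

lemma weight_move (ℓ : Fin d → ℝ) (v : Grid d n) {D : Config (Grid d n)} {x y : Grid d n} {c : ℕ}
    (hc : c ≤ D x) :
    weight ℓ v (D - Pi.single x c + Pi.single y 1) =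
      weight ℓ v D - c * Real.exp (-gridDist ℓ v x) + Real.exp (-gridDist ℓ v y) := by
  have h : ∀ w, (((D - Pi.single x c + Pi.single y 1 : Config (Grid d n)) w : ℕ) : ℝ) =
      (D w : ℝ) - (if w = x then (c : ℝ) else 0) + (if w = y then 1 else 0) := by
    intro w
    simp only [Pi.add_apply, Pi.sub_apply, Pi.single_apply]
    by_cases hw : w = x
    · subst hw
      rw [if_pos rfl, if_pos rfl]
      push_cast [Nat.cast_sub hc]
      rfl
    · rw [if_neg hw, if_neg hw]
      push_cast
      simp
  simp only [weight, h, add_mul, sub_mul, Finset.sum_add_distrib, Finset.sum_sub_distrib, ite_mul,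
    zero_mul, one_mul, Finset.sum_ite_eq', Finset.mem_univ, if_true]

lemma weight_le_of_step (hq : ∀ i, 2 ≤ q i) (v : Grid d n) {D D' : Config (Grid d n)}
    (h : Step q D D') : weight (logs q) v D' ≤ weight (logs q) v D := by
  obtain ⟨i, x, y, hxy, hx, rfl⟩ := h
  rw [weight_move _ _ hx]
  have h1 := gridDist_le_of_adjAlong (fun i => (logs_pos hq i).le) hxy v
  have h2 : Real.exp (-gridDist (logs q) v y) ≤ q i * Real.exp (-gridDist (logs q) v x) := by
    rw [← exp_logs hq i, ← Real.exp_add]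
    exact Real.exp_le_exp.2 (by linarith)
  linarith

/-- No step increases the weight seen from `v`, and a pebble on `v` has weight `1`. -/
lemma one_le_weight_of_solvableAt (hq : ∀ i, 2 ≤ q i) {v : Grid d n} {D : Config (Grid d n)}
    (h : SolvableAt q D v) : 1 ≤ weight (logs q) v D := by
  obtain ⟨D', hD, hv⟩ := h
  have h1 : weight (logs q) v D' ≤ weight (logs q) v D := by
    clear hv
    induction hD with
    | refl => exact le_rfl
    | tail _ hs ih => exact (weight_le_of_step hq v hs).trans ih
  have h2 := le_weight (logs q) v D'
  have h3 : (1 : ℝ) ≤ D' v := by exact_mod_cast hv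
  linarith

/-- A bound on the weights seen from `v` of the configurations that are not `v`-solvable. -/
noncomputable def weightBound {d : ℕ} (q : Fin d → ℕ) : ℝ := (∑ i, (q i : ℝ)) * 8 ^ d

lemma weightBound_nonneg (q : Fin d → ℕ) : 0 ≤ weightBound q :=
  mul_nonneg (Finset.sum_nonneg fun _ _ => Nat.cast_nonneg _) (by positivity)

/-- Steps towards `v` keep the weight seen from `v` and remove pebbles. When no such step is
left, every vertex other than `v` holds a bounded number of pebbles, so a large weight
forces a pebble on `v`. -/
lemma solvableAt_of_weightBound_lt (hq : ∀ i, 2 ≤ q i) (v : Grid d n) (D : Config (Grid d n))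
    (h : weightBound q < weight (logs q) v D) : SolvableAt q D v := by
  induction hk : ∑ w, D w using Nat.strong_induction_on generalizing D with
  | _ k ih =>
    by_cases hv : 1 ≤ D v
    · exact ⟨D, Relation.ReflTransGen.refl, hv⟩
    by_cases hs : ∃ (i : Fin d) (x y : Grid d n), AdjAlong i x y ∧
        gridDist (logs q) v x = gridDist (logs q) v y + logs q i ∧ q i ≤ D x
    · obtain ⟨i, x, y, hxy, hd, hx⟩ := hs
      set D' := D - Pi.single x (q i) + Pi.single y 1 with hD'
      have hw : weight (logs q) v D' = weight (logs q) v D := by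
        rw [hD', weight_move _ _ hx, hd, neg_add_rev, Real.exp_add, Real.exp_neg (logs q i),
          exp_logs hq]
        have : (q i : ℝ) ≠ 0 := by have := hq i; positivity
        field_simp
        ring
      have hsum : ∑ w, D' w + q i = ∑ w, D w + 1 := by
        have e : D' + Pi.single x (q i) = D + Pi.single y 1 := by
          funext w
          simp only [hD', Pi.add_apply, Pi.sub_apply, Pi.single_apply]
          rcases eq_or_ne w x with rfl | h1 <;> split_ifs <;> first | contradiction | omega
        have e2 := congrArg (fun f : Config (Grid d n) => ∑ w, f w) e
        simpa [Finset.sum_add_distrib, Finset.sum_pi_single'] using e2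
      have := hq i
      obtain ⟨D'', h1, h2⟩ := ih (∑ w, D' w) (by omega) D' (by rw [hw]; exact h) rfl
      exact ⟨D'', Relation.ReflTransGen.head ⟨i, x, y, hxy, hx, hD'⟩ h1, h2⟩
    · exfalso
      push Not at hs
      refine absurd h (not_lt.2 ?_)
      have hb : ∀ w, (D w : ℝ) ≤ ∑ i, (q i : ℝ) := by
        intro w
        by_cases hwv : w = v
        · subst hwv
          have : D w = 0 := by omega
          rw [this]
          push_cast
          exact Finset.sum_nonneg fun _ _ => Nat.cast_nonneg _
        · obtain ⟨i, y, h1, h2⟩ := exists_adjAlong_approach (ℓ := logs q) hwv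
          have h3 : (D w : ℝ) ≤ q i := by exact_mod_cast (hs i w y h1 h2).le
          exact h3.trans (Finset.single_le_sum (f := fun i => (q i : ℝ))
            (fun _ _ => Nat.cast_nonneg _) (Finset.mem_univ i))
      rw [weight, weightBound]
      have h8 := sum_exp_gridDist_le (log_two_le_logs hq) v
      have h0 : 0 ≤ ∑ i, (q i : ℝ) := Finset.sum_nonneg fun _ _ => Nat.cast_nonneg _
      calc _ ≤ ∑ w, (∑ i, (q i : ℝ)) * Real.exp (-(gridDist (logs q) v w / 2)) := by
            refine Finset.sum_le_sum fun w _ => ?_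
            refine mul_le_mul (hb w) (Real.exp_le_exp.2 ?_) (Real.exp_pos _).le h0
            have := gridDist_nonneg (fun i => (logs_pos hq i).le) v w
            linarith
        _ ≤ _ := by
            rw [← Finset.mul_sum]
            exact mul_le_mul_of_nonneg_left h8 h0

lemma Step.add {D D' : Config (Grid d n)} (h : Step q D D') (E : Config (Grid d n)) :
    Step q (D + E) (D' + E) := by
  obtain ⟨i, x, y, hxy, hx, rfl⟩ := h
  refine ⟨i, x, y, hxy, hx.trans (by simp), ?_⟩
  funext w
  simp only [Pi.add_apply, Pi.sub_apply, Pi.single_apply]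
  rcases eq_or_ne w x with rfl | h1 <;> split_ifs <;> first | contradiction | omega

lemma Solvable.add {D : Config (Grid d n)} (h : Solvable q D) (E : Config (Grid d n)) :
    Solvable q (D + E) := by
  intro v
  obtain ⟨D', h1, h2⟩ := h v
  refine ⟨D' + E, ?_, h2.trans (by simp)⟩
  clear h2
  induction h1 with
  | refl => exact Relation.ReflTransGen.refl
  | tail _ hs ih => exact ih.tail (hs.add E)

lemma not_solvable_zero (hn : 1 ≤ n) (hq : ∀ i, 2 ≤ q i) :
    ¬ Solvable q (0 : Config (Grid d n)) := by
  intro h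
  have := one_le_weight_of_solvableAt hq (h fun _ => ⟨0, hn⟩)
  simp [weight] at this
  linarith

end Solvability

end Pebbling

/-! ### Counting configurations with prescribed values -/

namespace Pebbling

section Multichoose

lemma card_piAntidiag_nat {V : Type*} [DecidableEq V] (s : Finset V) (k : ℕ) :
    (s.piAntidiag k).card = s.card.multichoose k := by
  rw [← Finset.card_finsuppAntidiag_nat_eq_multichoose, Finset.finsuppAntidiag, Finset.card_map,
    Finset.card_attach]

lemma mem_piAntidiag_nat {V : Type*} [DecidableEq V] {s : Finset V} {k : ℕ} {D : V → ℕ} :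
    D ∈ s.piAntidiag k ↔ ∑ w ∈ s, D w = k ∧ ∀ w, D w ≠ 0 → w ∈ s :=
  Finset.mem_piAntidiag

lemma multichoose_pos {m : ℕ} (hm : 1 ≤ m) (k : ℕ) : 0 < m.multichoose k := by
  rw [Nat.multichoose_eq]
  exact Nat.choose_pos (by omega)

lemma multichoose_mul_add {m : ℕ} (hm : 1 ≤ m) (k : ℕ) :
    m.multichoose k * (m + k) = m * (m + 1).multichoose k := by
  obtain ⟨a, rfl⟩ := Nat.exists_eq_add_of_le' hm
  have h1 := Nat.add_choose_mul_factorial_mul_factorial a k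
  have h2 := Nat.add_choose_mul_factorial_mul_factorial (a + 1) k
  rw [Nat.multichoose_eq, Nat.multichoose_eq]
  rw [show a + 1 + k - 1 = a + k by omega, show a + 1 + 1 + k - 1 = a + 1 + k by omega]
  have h3 : (a + 1 + k).factorial = (a + 1 + k) * (a + k).factorial := by
    rw [show a + 1 + k = a + k + 1 by omega, Nat.factorial_succ]
  have h4 : (a + 1).factorial = (a + 1) * a.factorial := Nat.factorial_succ a
  have hp : 0 < a.factorial * k.factorial := Nat.mul_pos (Nat.factorial_pos _) (Nat.factorial_pos _)
  refine Nat.eq_of_mul_eq_mul_right hp ?_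
  rw [h3, h4, ← h1] at h2
  linarith

lemma succ_mul_multichoose_succ {m : ℕ} (hm : 1 ≤ m) (k : ℕ) :
    (k + 1) * m.multichoose (k + 1) = (m + k) * m.multichoose k := by
  obtain ⟨a, rfl⟩ := Nat.exists_eq_add_of_le' hm
  have h1 := Nat.add_choose_mul_factorial_mul_factorial a k
  have h2 := Nat.add_choose_mul_factorial_mul_factorial a (k + 1)
  rw [Nat.multichoose_eq, Nat.multichoose_eq]
  rw [show a + 1 + (k + 1) - 1 = a + (k + 1) by omega, show a + 1 + k - 1 = a + k by omega]
  have h3 : (a + (k + 1)).factorial = (a + 1 + k) * (a + k).factorial := by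
    rw [show a + (k + 1) = a + k + 1 by omega, Nat.factorial_succ]
    ring
  have h4 : (k + 1).factorial = (k + 1) * k.factorial := Nat.factorial_succ k
  have hp : 0 < a.factorial * k.factorial := Nat.mul_pos (Nat.factorial_pos _) (Nat.factorial_pos _)
  refine Nat.eq_of_mul_eq_mul_right hp ?_
  rw [h3, h4, ← h1] at h2
  linarith

lemma multichoose_le_right {m : ℕ} (hm : 1 ≤ m) {j k : ℕ} (h : j ≤ k) :
    m.multichoose j ≤ m.multichoose k := by
  obtain ⟨a, rfl⟩ := Nat.exists_eq_add_of_le' hm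
  rw [Nat.multichoose_eq, Nat.multichoose_eq]
  rw [show a + 1 + j - 1 = a + j by omega, show a + 1 + k - 1 = a + k by omega,
    ← Nat.choose_symm_add, ← Nat.choose_symm_add]
  exact Nat.choose_le_choose _ (by omega)

lemma multichoose_sub_mul_pow_le {m N : ℕ} (hN : N < m) (k : ℕ) :
    (m - N).multichoose k * (m + k) ^ N ≤ m ^ N * m.multichoose k := by
  induction N with
  | zero => simp
  | succ N ih =>
    have ih := ih (by omega)
    have h1 := multichoose_mul_add (m := m - (N + 1)) (by omega) k
    rw [show m - (N + 1) + 1 = m - N by omega] at h1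
    set M := m - (N + 1)
    have hMm : M ≤ m := by omega
    have h2 : M.multichoose k * (m + k) ≤ m * (m - N).multichoose k := by
      refine Nat.le_of_mul_le_mul_right ?_ (show 0 < M + k by omega)
      calc M.multichoose k * (m + k) * (M + k) = (M.multichoose k * (M + k)) * (m + k) := by ring
        _ = (m - N).multichoose k * (M * (m + k)) := by rw [h1]; ring
        _ ≤ (m - N).multichoose k * (m * (M + k)) := by
            refine Nat.mul_le_mul_left _ ?_
            nlinarith [Nat.mul_le_mul_right k hMm]
        _ = _ := by ring
    calc M.multichoose k * (m + k) ^ (N + 1) = (M.multichoose k * (m + k)) * (m + k) ^ N := by ring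
      _ ≤ (m * (m - N).multichoose k) * (m + k) ^ N := Nat.mul_le_mul_right _ h2
      _ = m * ((m - N).multichoose k * (m + k) ^ N) := by ring
      _ ≤ m * (m ^ N * m.multichoose k) := Nat.mul_le_mul_left _ ih
      _ = _ := by ring

/-- The share of the configurations of `k` pebbles on `m` vertices that have prescribed values,
with sum `r`, on `N` vertices is a quotient of falling factorials. -/
lemma multichoose_sub_mul_descFactorial {m k N r : ℕ} (hN : N < m) (hr : r ≤ k) :
    (m - N).multichoose (k - r) * (m + k - 1).descFactorial (N + r) =
      (m - 1).descFactorial N * k.descFactorial r * m.multichoose k := by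
  obtain ⟨a, rfl⟩ : ∃ a, m = N + a + 1 := ⟨m - N - 1, by omega⟩
  obtain ⟨b, rfl⟩ : ∃ b, k = r + b := ⟨k - r, by omega⟩
  rw [Nat.multichoose_eq, Nat.multichoose_eq]
  rw [show N + a + 1 - N + (r + b - r) - 1 = a + b by omega, show r + b - r = b by omega,
    show N + a + 1 + (r + b) - 1 = N + a + (r + b) by omega,
    show N + a + 1 - 1 = N + a by omega]
  have h1 := Nat.add_choose_mul_factorial_mul_factorial a b
  have h2 := Nat.add_choose_mul_factorial_mul_factorial (N + a) (r + b)
  have h3 := Nat.factorial_mul_descFactorial (show N + r ≤ N + a + (r + b) by omega)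
  have h4 := Nat.factorial_mul_descFactorial (show N ≤ N + a by omega)
  have h5 := Nat.factorial_mul_descFactorial (show r ≤ r + b by omega)
  rw [show N + a + (r + b) - (N + r) = a + b by omega] at h3
  rw [show N + a - N = a by omega] at h4
  rw [show r + b - r = b by omega] at h5
  have hp : 0 < a.factorial * b.factorial := Nat.mul_pos (Nat.factorial_pos _) (Nat.factorial_pos _)
  refine Nat.eq_of_mul_eq_mul_right hp ?_
  calc _ = ((a + b).choose b * a.factorial * b.factorial) *
        (N + a + (r + b)).descFactorial (N + r) := by ring
    _ = (N + a + (r + b)).choose (r + b) * (N + a).factorial * (r + b).factorial := by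
        rw [h1, h3, h2]
    _ = _ := by rw [← h4, ← h5]; ring

lemma descFactorial_add (X a b : ℕ) :
    X.descFactorial (a + b) = X.descFactorial a * (X - a).descFactorial b := by
  rw [mul_comm, ← Nat.descFactorial_mul_descFactorial (Nat.le_add_right a b),
    Nat.add_sub_cancel_left]

lemma descFactorial_add_le (X a b : ℕ) :
    X.descFactorial (a + b) ≤ X.descFactorial a * X.descFactorial b := by
  rw [descFactorial_add]
  exact Nat.mul_le_mul_left _ (Nat.descFactorial_le _ (Nat.sub_le _ _))

lemma descFactorial_mul_pow_le {k X : ℕ} (h : k ≤ X) (r : ℕ) :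
    k.descFactorial r * X ^ r ≤ k ^ r * X.descFactorial r := by
  induction r with
  | zero => simp
  | succ r ih =>
    rw [Nat.descFactorial_succ, Nat.descFactorial_succ]
    have h1 : (k - r) * X ≤ k * (X - r) := by
      rcases le_total k r with h' | h'
      · simp [Nat.sub_eq_zero_of_le h']
      · obtain ⟨a, rfl⟩ := Nat.exists_eq_add_of_le h'
        obtain ⟨b, rfl⟩ := Nat.exists_eq_add_of_le h
        rw [show r + a - r = a by omega, show r + a + b - r = a + b by omega]
        nlinarith [Nat.zero_le (r * b)]
    calc (k - r) * k.descFactorial r * X ^ (r + 1) =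
          ((k - r) * X) * (k.descFactorial r * X ^ r) := by
          ring
      _ ≤ (k * (X - r)) * (k ^ r * X.descFactorial r) := Nat.mul_le_mul h1 ih
      _ = _ := by ring

/-- Prescribed values on two disjoint sets of vertices are almost independent, in the direction
needed for a second moment argument. -/
lemma multichoose_sub_almost_indep {m k N₁ N₂ r₁ r₂ S : ℕ} (hN : N₁ + N₂ < m) (hr : r₁ + r₂ ≤ k)
    (h₁ : N₁ + r₁ ≤ S) (h₂ : N₂ + r₂ ≤ S) :
    (1 - 2 * (S : ℝ) ^ 2 / (m + k - 1 : ℕ)) *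
      ((m - (N₁ + N₂)).multichoose (k - (r₁ + r₂)) * m.multichoose k : ℝ) ≤
      (m - N₁).multichoose (k - r₁) * (m - N₂).multichoose (k - r₂) := by
  have e₁ := multichoose_sub_mul_descFactorial (m := m) (k := k) (N := N₁) (r := r₁)
    (by omega) (by omega)
  have e₂ := multichoose_sub_mul_descFactorial (m := m) (k := k) (N := N₂) (r := r₂)
    (by omega) (by omega)
  have e := multichoose_sub_mul_descFactorial hN hr
  rw [show N₁ + N₂ + (r₁ + r₂) = (N₁ + r₁) + (N₂ + r₂) by ring] at e
  set X := m + k - 1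
  set s₁ := N₁ + r₁
  set s₂ := N₂ + r₂
  have hsX : s₁ + s₂ ≤ X := by omega
  set G := (m - (N₁ + N₂)).multichoose (k - (r₁ + r₂))
  set G₁ := (m - N₁).multichoose (k - r₁)
  set G₂ := (m - N₂).multichoose (k - r₂)
  set T := m.multichoose k
  have k1 : G * T * X.descFactorial (s₁ + s₂) ≤
      G₁ * G₂ * (X.descFactorial s₁ * X.descFactorial s₂) := by
    calc G * T * X.descFactorial (s₁ + s₂) = T * (G * X.descFactorial (s₁ + s₂)) := by ring
      _ = T * ((m - 1).descFactorial (N₁ + N₂) * k.descFactorial (r₁ + r₂) * T) := by rw [e]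
      _ ≤ T * (((m - 1).descFactorial N₁ * (m - 1).descFactorial N₂) *
            (k.descFactorial r₁ * k.descFactorial r₂) * T) := by
          refine Nat.mul_le_mul_left _ (Nat.mul_le_mul_right _ (Nat.mul_le_mul ?_ ?_)) <;>
          exact descFactorial_add_le _ _ _
      _ = ((m - 1).descFactorial N₁ * k.descFactorial r₁ * T) *
            ((m - 1).descFactorial N₂ * k.descFactorial r₂ * T) := by ring
      _ = (G₁ * X.descFactorial s₁) * (G₂ * X.descFactorial s₂) := by rw [← e₁, ← e₂]
      _ = _ := by ring
  have hp1 : 0 < X.descFactorial s₁ := Nat.descFactorial_pos.2 (by omega)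
  have k2 : G * T * (X - s₁).descFactorial s₂ ≤ G₁ * G₂ * X.descFactorial s₂ := by
    rw [descFactorial_add] at k1
    refine Nat.le_of_mul_le_mul_left ?_ hp1
    calc _ = G * T * (X.descFactorial s₁ * (X - s₁).descFactorial s₂) := by ring
      _ ≤ _ := k1
      _ = _ := by ring
  have k3 : (X - (s₁ + s₂)) ^ s₂ ≤ (X - s₁).descFactorial s₂ := by
    refine le_trans ?_ (Nat.pow_sub_le_descFactorial (X - s₁) s₂)
    exact Nat.pow_le_pow_left (by omega) _
  rcases Nat.eq_zero_or_pos X with hX0 | hX0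
  · have h1 : s₁ = 0 := by omega
    have h2 : s₂ = 0 := by omega
    rw [h2] at k2
    simp only [Nat.descFactorial_zero, mul_one] at k2
    rw [hX0]
    simp only [Nat.cast_zero, div_zero, sub_zero, one_mul]
    exact_mod_cast k2
  have hXr : (0 : ℝ) < X := by exact_mod_cast hX0
  have k4 : (1 - 2 * (S : ℝ) ^ 2 / X) * (X.descFactorial s₂ : ℝ) ≤
      ((X - s₁).descFactorial s₂ : ℝ) := by
    have b1 : (-2 : ℝ) ≤ -((s₁ + s₂ : ℕ) : ℝ) / X := by
      rw [le_div_iff₀ hXr]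
      have : ((s₁ + s₂ : ℕ) : ℝ) ≤ X := by exact_mod_cast hsX
      linarith
    have b2 := one_add_mul_le_pow b1 s₂
    have b3 : (1 - 2 * (S : ℝ) ^ 2 / X) ≤ 1 + (s₂ : ℝ) * (-((s₁ + s₂ : ℕ) : ℝ) / X) := by
      have : (s₂ : ℝ) * ((s₁ + s₂ : ℕ) : ℝ) ≤ 2 * (S : ℝ) ^ 2 := by
        have a1 : (s₂ : ℝ) ≤ S := by exact_mod_cast h₂
        have a2 : ((s₁ + s₂ : ℕ) : ℝ) ≤ 2 * S := by
          exact_mod_cast (show s₁ + s₂ ≤ 2 * S by omega)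
        calc _ ≤ (S : ℝ) * (2 * S) := mul_le_mul a1 a2 (Nat.cast_nonneg _) (Nat.cast_nonneg _)
          _ = _ := by ring
      have := div_le_div_of_nonneg_right this hXr.le
      have e : (s₂ : ℝ) * (-((s₁ + s₂ : ℕ) : ℝ) / X) = -((s₂ : ℝ) * ((s₁ + s₂ : ℕ) : ℝ) / X) := by
        ring
      rw [e]
      linarith
    have b4 : (X.descFactorial s₂ : ℝ) ≤ (X : ℝ) ^ s₂ := by
      exact_mod_cast Nat.descFactorial_le_pow X s₂
    have b5 : (1 + -((s₁ + s₂ : ℕ) : ℝ) / X) ^ s₂ * (X : ℝ) ^ s₂ =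
        ((X - (s₁ + s₂) : ℕ) : ℝ) ^ s₂ := by
      rw [← mul_pow, Nat.cast_sub hsX]
      congr 1
      field_simp
      ring
    have b6 : (((X - (s₁ + s₂)) ^ s₂ : ℕ) : ℝ) ≤ ((X - s₁).descFactorial s₂ : ℕ) := by
      exact_mod_cast k3
    push_cast at b6
    by_cases hneg : 1 - 2 * (S : ℝ) ^ 2 / X ≤ 0
    · exact (mul_nonpos_of_nonpos_of_nonneg hneg (Nat.cast_nonneg _)).trans (Nat.cast_nonneg _)
    · push Not at hneg
      calc _ ≤ (1 - 2 * (S : ℝ) ^ 2 / X) * (X : ℝ) ^ s₂ := mul_le_mul_of_nonneg_left b4 hneg.le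
        _ ≤ (1 + -((s₁ + s₂ : ℕ) : ℝ) / X) ^ s₂ * (X : ℝ) ^ s₂ :=
            mul_le_mul_of_nonneg_right (b3.trans b2) (by positivity)
        _ = _ := b5
        _ ≤ _ := b6
  have hp2 : (0 : ℝ) < X.descFactorial s₂ := by
    exact_mod_cast Nat.descFactorial_pos.2 (show s₂ ≤ X by omega)
  refine le_of_mul_le_mul_right ?_ hp2
  calc (1 - 2 * (S : ℝ) ^ 2 / X) * ((G : ℝ) * T) * X.descFactorial s₂
      = ((G : ℝ) * T) * ((1 - 2 * (S : ℝ) ^ 2 / X) * X.descFactorial s₂) := by ring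
    _ ≤ ((G : ℝ) * T) * ((X - s₁).descFactorial s₂ : ℝ) :=
        mul_le_mul_of_nonneg_left k4 (by positivity)
    _ ≤ _ := by exact_mod_cast k2

lemma le_multichoose_sub {m k N r R : ℕ} (hN : N < m) (hr : r ≤ R) (hR : R ≤ k) :
    (((m : ℝ) - N) / (m + k)) ^ N * (((k : ℝ) - R) / (m + k)) ^ R * m.multichoose k ≤
      (m - N).multichoose (k - r) := by
  have e := multichoose_sub_mul_descFactorial (m := m) (k := k) hN (hr.trans hR)
  set X := m + k - 1
  have hmk : (0 : ℝ) < (m : ℝ) + k := by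
    have : 0 < m := by omega
    positivity
  have h1 : ((m : ℝ) - N) ^ N ≤ (m - 1).descFactorial N := by
    have := Nat.pow_sub_le_descFactorial (m - 1) N
    rw [show m - 1 + 1 - N = m - N by omega] at this
    rw [← Nat.cast_sub hN.le]
    exact_mod_cast this
  have h2 : ((k : ℝ) - R) ^ r ≤ k.descFactorial r := by
    have := Nat.pow_sub_le_descFactorial k r
    rw [← Nat.cast_sub hR]
    have h' : (k - R) ^ r ≤ (k + 1 - r) ^ r := Nat.pow_le_pow_left (by omega) _
    exact_mod_cast h'.trans this
  have h3 : (X.descFactorial (N + r) : ℝ) ≤ ((m : ℝ) + k) ^ (N + r) := by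
    have := (Nat.descFactorial_le_pow X (N + r)).trans
      (Nat.pow_le_pow_left (show X ≤ m + k by omega) _)
    exact_mod_cast this
  have hp : (0 : ℝ) < X.descFactorial (N + r) := by
    exact_mod_cast Nat.descFactorial_pos.2 (show N + r ≤ X by omega)
  have hNm : (0 : ℝ) ≤ (m : ℝ) - N := by
    have : (N : ℝ) ≤ m := by exact_mod_cast hN.le
    linarith
  have hRk : (0 : ℝ) ≤ (k : ℝ) - R := by
    have : (R : ℝ) ≤ k := by exact_mod_cast hR
    linarith
  have hb : (((k : ℝ) - R) / (m + k)) ^ R ≤ (((k : ℝ) - R) / (m + k)) ^ r := by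
    refine pow_le_pow_of_le_one (by positivity) ?_ hr
    rw [div_le_one hmk]
    have : (0 : ℝ) ≤ m := Nat.cast_nonneg _
    have : (0 : ℝ) ≤ R := Nat.cast_nonneg _
    linarith
  refine le_of_mul_le_mul_right ?_ hp
  have e' : ((m - N).multichoose (k - r) : ℝ) * X.descFactorial (N + r) =
      (m - 1).descFactorial N * k.descFactorial r * m.multichoose k := by exact_mod_cast e
  rw [e']
  calc _ ≤ (((m : ℝ) - N) / (m + k)) ^ N * (((k : ℝ) - R) / (m + k)) ^ r * m.multichoose k *
        ((m : ℝ) + k) ^ (N + r) := by gcongr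
    _ = ((m : ℝ) - N) ^ N * ((k : ℝ) - R) ^ r * m.multichoose k := by
        rw [div_pow, div_pow, pow_add]
        field_simp
    _ ≤ _ := by gcongr

end Multichoose

section Counting

variable {V : Type*} [Fintype V] [DecidableEq V]

/-- The functions that vanish off `A` and are at most `c` on `A`. -/
def boxes (A : Finset V) (c : V → ℕ) : Finset (V → ℕ) :=
  Fintype.piFinset fun w => if w ∈ A then Finset.range (c w + 1) else {0}

lemma mem_boxes {A : Finset V} {c x : V → ℕ} :
    x ∈ boxes A c ↔ (∀ w ∈ A, x w ≤ c w) ∧ ∀ w ∉ A, x w = 0 := by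
  rw [boxes, Fintype.mem_piFinset]
  constructor
  · intro h
    refine ⟨fun w hw => ?_, fun w hw => ?_⟩
    · have := h w
      rw [if_pos hw, Finset.mem_range] at this
      omega
    · have := h w
      rw [if_neg hw, Finset.mem_singleton] at this
      exact this
  · rintro ⟨h1, h2⟩ w
    by_cases hw : w ∈ A
    · rw [if_pos hw, Finset.mem_range]
      have := h1 w hw
      omega
    · rw [if_neg hw, Finset.mem_singleton]
      exact h2 w hw

lemma card_boxes (A : Finset V) (c : V → ℕ) : (boxes A c).card = ∏ w ∈ A, (c w + 1) := by
  rw [boxes, Fintype.card_piFinset, ← Finset.prod_subset (Finset.subset_univ A)]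
  · exact Finset.prod_congr rfl fun w hw => by rw [if_pos hw, Finset.card_range]
  · intro w _ hw
    rw [if_neg hw, Finset.card_singleton]

lemma sum_le_of_mem_boxes {A : Finset V} {c x : V → ℕ} (h : x ∈ boxes A c) :
    ∑ w ∈ A, x w ≤ ∑ w ∈ A, c w :=
  Finset.sum_le_sum fun w hw => (mem_boxes.1 h).1 w hw

/-- The number of configurations with prescribed values on `A`. -/
lemma card_filter_eq_on (A : Finset V) (x : V → ℕ) {k : ℕ} (h : ∑ w ∈ A, x w ≤ k) :
    ((Finset.univ.piAntidiag k).filter fun D : V → ℕ => ∀ w ∈ A, D w = x w).card =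
      (Fintype.card V - A.card).multichoose (k - ∑ w ∈ A, x w) := by
  rw [← Finset.card_compl, ← card_piAntidiag_nat]
  refine Finset.card_nbij' (fun D w => if w ∈ A then 0 else D w)
    (fun E w => if w ∈ A then x w else E w) ?_ ?_ ?_ ?_
  · intro D hD
    simp only [Finset.coe_filter, mem_piAntidiag_nat, Set.mem_ofPred_eq] at hD
    obtain ⟨⟨h1, -⟩, h2⟩ := hD
    simp only [Finset.mem_coe, mem_piAntidiag_nat]
    have hs := Finset.sum_add_sum_compl A D
    rw [Finset.sum_congr rfl (g := fun w => x w) h2] at hs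
    refine ⟨?_, fun w hw => ?_⟩
    · rw [Finset.sum_congr rfl (g := fun w => D w)
        (fun w hw => by rw [if_neg (Finset.mem_compl.1 hw)])]
      omega
    · rw [Finset.mem_compl]
      intro hw'
      exact hw (if_pos hw')
  · intro E hE
    simp only [Finset.mem_coe, mem_piAntidiag_nat] at hE
    obtain ⟨h1, -⟩ := hE
    simp only [Finset.coe_filter, mem_piAntidiag_nat, Set.mem_ofPred_eq]
    refine ⟨⟨?_, fun _ _ => Finset.mem_univ _⟩, fun w hw => if_pos hw⟩
    have hs := Finset.sum_add_sum_compl A (fun w => if w ∈ A then x w else E w)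
    rw [Finset.sum_congr rfl (g := fun w => x w) (fun w hw => if_pos hw),
      Finset.sum_congr rfl (s₁ := Aᶜ) (g := fun w => E w)
        (fun w hw => if_neg (Finset.mem_compl.1 hw))] at hs
    omega
  · intro D hD
    simp only [Finset.coe_filter, Set.mem_ofPred_eq] at hD
    funext w
    by_cases hw : w ∈ A
    · simp [hw, hD.2 w hw]
    · simp [hw]
  · intro E hE
    simp only [Finset.mem_coe, mem_piAntidiag_nat] at hE
    funext w
    by_cases hw : w ∈ A
    · have : E w = 0 := by
        by_contra hne
        exact Finset.mem_compl.1 (hE.2 w hne) hw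
      simp [hw, this]
    · simp [hw]

lemma le_of_mem_piAntidiag {k : ℕ} {D : V → ℕ} (h : D ∈ Finset.univ.piAntidiag k) (w : V) :
    D w ≤ k := by
  rw [mem_piAntidiag_nat] at h
  rw [← h.1]
  exact Finset.single_le_sum (f := D) (fun _ _ => Nat.zero_le _) (Finset.mem_univ w)

lemma card_filter_eq_on_le {A : Finset V} (hA : A.card < Fintype.card V) (x : V → ℕ) (k : ℕ) :
    (((Finset.univ.piAntidiag k).filter fun D : V → ℕ => ∀ w ∈ A, D w = x w).card : ℝ) ≤
      ((Fintype.card V : ℝ) / (Fintype.card V + k)) ^ A.card *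
        (Fintype.card V).multichoose k := by
  set m := Fintype.card V with hm
  have hm0 : 0 < m := by omega
  by_cases h : ∑ w ∈ A, x w ≤ k
  · rw [card_filter_eq_on A x h, ← hm]
    have h1 := multichoose_sub_mul_pow_le hA k
    have h2 : (m - A.card).multichoose (k - ∑ w ∈ A, x w) ≤ (m - A.card).multichoose k :=
      multichoose_le_right (by omega) (by omega)
    rw [div_pow, div_mul_eq_mul_div, le_div_iff₀ (by positivity)]
    have h3 := (Nat.mul_le_mul_right ((m + k) ^ A.card) h2).trans h1
    exact_mod_cast h3
  · rw [Finset.card_eq_zero.2, Nat.cast_zero]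
    · positivity
    · rw [Finset.filter_eq_empty_iff]
      intro D hD hx
      rw [mem_piAntidiag_nat] at hD
      have h1 : ∑ w ∈ A, D w ≤ Finset.univ.sum D :=
        Finset.sum_le_sum_of_subset (Finset.subset_univ A)
      rw [Finset.sum_congr rfl hx, hD.1] at h1
      exact h h1

/-- The expectation of a product of functions of the numbers of pebbles on the vertices of `A` is
at most what it would be if every value on `A` had probability `(m / (m + k)) ^ |A|`. -/
lemma sum_prod_le {A : Finset V} (hA : A.card < Fintype.card V) (k : ℕ) (g : V → ℕ → ℝ)
    (hg : ∀ w j, 0 ≤ g w j) :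
    ∑ D ∈ Finset.univ.piAntidiag k, ∏ w ∈ A, g w (D w) ≤
      ((Fintype.card V : ℝ) / (Fintype.card V + k)) ^ A.card * (Fintype.card V).multichoose k *
        ∏ w ∈ A, ∑ j ∈ Finset.range (k + 1), g w j := by
  have hmap : ∀ D ∈ (Finset.univ : Finset V).piAntidiag k,
      (fun w => if w ∈ A then D w else 0) ∈ boxes A fun _ => k := by
    intro D hD
    rw [mem_boxes]
    exact ⟨fun w hw => by rw [if_pos hw]; exact le_of_mem_piAntidiag hD w, fun w hw => if_neg hw⟩
  rw [← Finset.sum_fiberwise_of_maps_to hmap]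
  have hbox : ∑ x ∈ boxes A (fun _ => k), ∏ w ∈ A, g w (x w) =
      ∏ w ∈ A, ∑ j ∈ Finset.range (k + 1), g w j := by
    have h := Finset.prod_univ_sum (fun w => if w ∈ A then Finset.range (k + 1) else {0})
      (fun w j => if w ∈ A then g w j else 1)
    rw [← Finset.prod_subset (Finset.subset_univ A)] at h
    · rw [Finset.prod_congr rfl (g := fun w => ∑ j ∈ Finset.range (k + 1), g w j)] at h
      · rw [h, boxes]
        refine Finset.sum_congr rfl fun x _ => ?_
        rw [← Finset.prod_subset (Finset.subset_univ A)]
        · exact Finset.prod_congr rfl fun w hw => by rw [if_pos hw]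
        · intro w _ hw
          rw [if_neg hw]
      · intro w hw
        simp only [if_pos hw]
    · intro w _ hw
      simp only [if_neg hw, Finset.sum_singleton]
  rw [← hbox, Finset.mul_sum]
  refine Finset.sum_le_sum fun x hx => ?_
  have h1 : ∀ D ∈ (Finset.univ.piAntidiag k).filter
      (fun D : V → ℕ => (fun w => if w ∈ A then D w else 0) = x),
      ∏ w ∈ A, g w (D w) = ∏ w ∈ A, g w (x w) := by
    intro D hD
    refine Finset.prod_congr rfl fun w hw => ?_
    simp [← (Finset.mem_filter.1 hD).2, hw]
  rw [Finset.sum_congr rfl h1, Finset.sum_const, nsmul_eq_mul]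
  refine mul_le_mul_of_nonneg_right ?_ (Finset.prod_nonneg fun w _ => hg w _)
  refine le_trans ?_ (card_filter_eq_on_le hA x k)
  refine Nat.cast_le.2 (Finset.card_le_card ?_)
  intro D hD
  rw [Finset.mem_filter] at hD ⊢
  refine ⟨hD.1, fun w hw => ?_⟩
  simp [← hD.2, hw]

/-- The event that the number of pebbles on each `w ∈ A` is at most `c w` splits according to
the values on `A`. -/
lemma card_filter_le_on (A : Finset V) (c : V → ℕ) {k : ℕ} (h : ∑ w ∈ A, c w ≤ k) :
    ((Finset.univ.piAntidiag k).filter fun D : V → ℕ => ∀ w ∈ A, D w ≤ c w).card =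
      ∑ x ∈ boxes A c, (Fintype.card V - A.card).multichoose (k - ∑ w ∈ A, x w) := by
  have hmap : ∀ D ∈ ((Finset.univ : Finset V).piAntidiag k).filter fun D => ∀ w ∈ A, D w ≤ c w,
      (fun w => if w ∈ A then D w else 0) ∈ boxes A c := by
    intro D hD
    rw [mem_boxes]
    exact ⟨fun w hw => by rw [if_pos hw]; exact (Finset.mem_filter.1 hD).2 w hw,
      fun w hw => if_neg hw⟩
  rw [Finset.card_eq_sum_card_fiberwise hmap]
  refine Finset.sum_congr rfl fun x hx => ?_
  rw [← card_filter_eq_on A x ((sum_le_of_mem_boxes hx).trans h), Finset.filter_filter]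
  congr 1
  refine Finset.filter_congr fun D _ => ?_
  have hx' := mem_boxes.1 hx
  constructor
  · rintro ⟨-, h2⟩ w hw
    simp [← h2, hw]
  · intro h2
    refine ⟨fun w hw => by rw [h2 w hw]; exact hx'.1 w hw, ?_⟩
    funext w
    by_cases hw : w ∈ A
    · rw [if_pos hw, h2 w hw]
    · rw [if_neg hw, hx'.2 w hw]

lemma card_filter_le_on_inter {A B : Finset V} (hAB : Disjoint A B) (c e : V → ℕ) {k : ℕ}
    (h : ∑ w ∈ A, c w + ∑ w ∈ B, e w ≤ k) :
    ((Finset.univ.piAntidiag k).filter fun D : V → ℕ =>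
        (∀ w ∈ A, D w ≤ c w) ∧ ∀ w ∈ B, D w ≤ e w).card =
      ∑ x ∈ boxes A c, ∑ y ∈ boxes B e, (Fintype.card V - (A.card + B.card)).multichoose
        (k - (∑ w ∈ A, x w + ∑ w ∈ B, y w)) := by
  have hmap : ∀ D ∈ ((Finset.univ : Finset V).piAntidiag k).filter (fun D : V → ℕ =>
        (∀ w ∈ A, D w ≤ c w) ∧ ∀ w ∈ B, D w ≤ e w),
      ((fun w => if w ∈ A then D w else 0, fun w => if w ∈ B then D w else 0) :
        (V → ℕ) × (V → ℕ)) ∈ boxes A c ×ˢ boxes B e := by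
    intro D hD
    rw [Finset.mem_filter] at hD
    rw [Finset.mem_product, mem_boxes, mem_boxes]
    exact ⟨⟨fun w hw => by simp only [if_pos hw]; exact hD.2.1 w hw, fun w hw => if_neg hw⟩,
      ⟨fun w hw => by simp only [if_pos hw]; exact hD.2.2 w hw, fun w hw => if_neg hw⟩⟩
  rw [Finset.card_eq_sum_card_fiberwise hmap, Finset.sum_product]
  refine Finset.sum_congr rfl fun x hx => Finset.sum_congr rfl fun y hy => ?_
  have hx' := mem_boxes.1 hx
  have hy' := mem_boxes.1 hy
  have hsA : ∑ w ∈ A, (x w + y w) = ∑ w ∈ A, x w := by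
    refine Finset.sum_congr rfl fun w hw => ?_
    rw [hy'.2 w (Finset.disjoint_left.1 hAB hw), add_zero]
  have hsB : ∑ w ∈ B, (x w + y w) = ∑ w ∈ B, y w := by
    refine Finset.sum_congr rfl fun w hw => ?_
    rw [hx'.2 w (Finset.disjoint_right.1 hAB hw), zero_add]
  have hs : ∑ w ∈ A ∪ B, (x w + y w) = ∑ w ∈ A, x w + ∑ w ∈ B, y w := by
    rw [Finset.sum_union hAB, hsA, hsB]
  have hle : ∑ w ∈ A ∪ B, (x w + y w) ≤ k := by
    rw [hs]
    exact (add_le_add (sum_le_of_mem_boxes hx) (sum_le_of_mem_boxes hy)).trans h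
  rw [← Finset.card_union_of_disjoint hAB, ← hs,
    ← card_filter_eq_on (A ∪ B) (fun w => x w + y w) hle,
    Finset.filter_filter]
  congr 1
  refine Finset.filter_congr fun D _ => ?_
  constructor
  · rintro ⟨-, h2⟩ w hw
    rw [Prod.mk.injEq] at h2
    rcases Finset.mem_union.1 hw with hw | hw
    · rw [hy'.2 w (Finset.disjoint_left.1 hAB hw), ← h2.1]
      simp [hw]
    · rw [hx'.2 w (Finset.disjoint_right.1 hAB hw), ← h2.2]
      simp [hw]
  · intro h2
    have hDA : ∀ w ∈ A, D w = x w := fun w hw => by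
      rw [h2 w (Finset.mem_union_left _ hw), hy'.2 w (Finset.disjoint_left.1 hAB hw), add_zero]
    have hDB : ∀ w ∈ B, D w = y w := fun w hw => by
      rw [h2 w (Finset.mem_union_right _ hw), hx'.2 w (Finset.disjoint_right.1 hAB hw), zero_add]
    refine ⟨⟨fun w hw => by rw [hDA w hw]; exact hx'.1 w hw,
      fun w hw => by rw [hDB w hw]; exact hy'.1 w hw⟩, ?_⟩
    rw [Prod.mk.injEq]
    constructor <;> funext w
    · by_cases hw : w ∈ A
      · rw [if_pos hw, hDA w hw]
      · rw [if_neg hw, hx'.2 w hw]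
    · by_cases hw : w ∈ B
      · rw [if_pos hw, hDB w hw]
      · rw [if_neg hw, hy'.2 w hw]

lemma card_filter_le_on_ge {A : Finset V} (hA : A.card < Fintype.card V) (c : V → ℕ) {k R : ℕ}
    (hc : ∑ w ∈ A, c w ≤ R) (hR : R ≤ k) :
    (∏ w ∈ A, ((c w : ℝ) + 1)) *
        ((((Fintype.card V : ℝ) - A.card) / (Fintype.card V + k)) ^ A.card *
        (((k : ℝ) - R) / (Fintype.card V + k)) ^ R) * (Fintype.card V).multichoose k ≤
      ((Finset.univ.piAntidiag k).filter fun D : V → ℕ => ∀ w ∈ A, D w ≤ c w).card := by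
  rw [card_filter_le_on A c (hc.trans hR)]
  push_cast
  have h := Finset.card_nsmul_le_sum (boxes A c)
    (fun x => ((Fintype.card V - A.card).multichoose (k - ∑ w ∈ A, x w) : ℝ)) _
    (fun x hx => le_multichoose_sub hA ((sum_le_of_mem_boxes hx).trans hc) hR)
  rw [card_boxes, nsmul_eq_mul] at h
  push_cast at h
  linarith

lemma card_filter_le_on_inter_le {A B : Finset V} (hAB : Disjoint A B) (c e : V → ℕ) {k S : ℕ}
    (hcard : A.card + B.card < Fintype.card V)
    (h : ∑ w ∈ A, c w + ∑ w ∈ B, e w ≤ k) (hA : A.card + ∑ w ∈ A, c w ≤ S)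
    (hB : B.card + ∑ w ∈ B, e w ≤ S) :
    (1 - 2 * (S : ℝ) ^ 2 / (Fintype.card V + k - 1 : ℕ)) *
      ((((Finset.univ.piAntidiag k).filter fun D : V → ℕ =>
        (∀ w ∈ A, D w ≤ c w) ∧ ∀ w ∈ B, D w ≤ e w).card : ℝ) * (Fintype.card V).multichoose k) ≤
      ((Finset.univ.piAntidiag k).filter fun D : V → ℕ => ∀ w ∈ A, D w ≤ c w).card *
      ((Finset.univ.piAntidiag k).filter fun D : V → ℕ => ∀ w ∈ B, D w ≤ e w).card := by
  rw [card_filter_le_on_inter hAB c e h, card_filter_le_on A c (by omega),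
    card_filter_le_on B e (by omega)]
  push_cast
  rw [Finset.sum_mul_sum, Finset.sum_mul, Finset.mul_sum]
  refine Finset.sum_le_sum fun x hx => ?_
  rw [Finset.sum_mul, Finset.mul_sum]
  refine Finset.sum_le_sum fun y hy => ?_
  have hx := sum_le_of_mem_boxes hx
  have hy := sum_le_of_mem_boxes hy
  exact multichoose_sub_almost_indep hcard (by omega) (by omega) (by omega)

lemma card_filter_ge_le (hV : 0 < Fintype.card V) (w : V) (r k : ℕ) :
    (((Finset.univ.piAntidiag k).filter fun D : V → ℕ => r ≤ D w).card : ℝ) ≤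
      ((k : ℝ) / (Fintype.card V + k - 1 : ℕ)) ^ r * (Fintype.card V).multichoose k := by
  set m := Fintype.card V with hm
  by_cases hr : r ≤ k
  · have h1 : ((Finset.univ.piAntidiag k).filter fun D : V → ℕ => r ≤ D w).card ≤
        m.multichoose (k - r) := by
      rw [hm, ← Finset.card_univ, ← card_piAntidiag_nat]
      refine Finset.card_le_card_of_injOn (fun D => D - Pi.single w r) ?_ ?_
      · intro D hD
        simp only [Finset.coe_filter, mem_piAntidiag_nat, Set.mem_ofPred_eq] at hD
        simp only [Finset.mem_coe, mem_piAntidiag_nat]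
        refine ⟨?_, fun _ _ => Finset.mem_univ _⟩
        have e : (D - Pi.single w r) + Pi.single w r = D := by
          funext u
          simp only [Pi.add_apply, Pi.sub_apply, Pi.single_apply]
          split_ifs with h
          · rw [h]; omega
          · omega
        have e2 := congrArg (fun f : V → ℕ => ∑ u, f u) e
        simp only [Pi.add_apply, Pi.sub_apply, Finset.sum_add_distrib, Finset.sum_pi_single',
          Finset.mem_univ,
          if_true] at e2
        have h1 := hD.1.1
        change ∑ u, (D u - (Pi.single w r : V → ℕ) u) = k - r
        omega
      · intro D hD E hE hDE
        simp only [Finset.coe_filter, Set.mem_ofPred_eq] at hD hE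
        funext u
        have := congrFun hDE u
        simp only [Pi.sub_apply, Pi.single_apply] at this
        split_ifs at this with h
        · rw [h] at this ⊢; omega
        · omega
    have h2 := multichoose_sub_mul_descFactorial (m := m) (k := k) (N := 0) (r := r) hV hr
    simp only [Nat.sub_zero, zero_add, Nat.descFactorial_zero, one_mul] at h2
    have h3 := descFactorial_mul_pow_le (show k ≤ m + k - 1 by omega) r
    rcases Nat.eq_zero_or_pos r with h0 | h0
    · subst h0
      simp only [pow_zero, one_mul]
      rw [Nat.sub_zero] at h1
      exact_mod_cast h1
    have hX : 0 < m + k - 1 := by omega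
    have hp : 0 < (m + k - 1).descFactorial r := Nat.descFactorial_pos.2 (by omega)
    rw [div_pow, div_mul_eq_mul_div, le_div_iff₀ (by positivity)]
    refine (mul_le_mul_of_nonneg_right (Nat.cast_le.2 h1) (by positivity)).trans ?_
    have h4 : m.multichoose (k - r) * (m + k - 1) ^ r ≤ k ^ r * m.multichoose k := by
      refine Nat.le_of_mul_le_mul_right ?_ hp
      calc _ = (m.multichoose (k - r) * (m + k - 1).descFactorial r) * (m + k - 1) ^ r := by ring
        _ = (k.descFactorial r * (m + k - 1) ^ r) * m.multichoose k := by rw [h2]; ring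
        _ ≤ (k ^ r * (m + k - 1).descFactorial r) * m.multichoose k := Nat.mul_le_mul_right _ h3
        _ = _ := by ring
    exact_mod_cast h4
  · rw [Finset.card_eq_zero.2, Nat.cast_zero]
    · positivity
    · rw [Finset.filter_eq_empty_iff]
      intro D hD h
      exact hr (h.trans (le_of_mem_piAntidiag hD w))

lemma second_moment_arith {η μ Z M Y Q : ℝ} (hη' : η ≤ 1 / 2) (hμ : 0 < μ)
    (hZ : 0 < Z) (hM : 0 < M) (hY : 0 ≤ Y) (hE : μ * Z ≤ M)
    (h₁ : (1 - η) * Q * Z ≤ M * Z + M ^ 2) (h₂ : Y * M ^ 2 ≤ Q * Z ^ 2 - M ^ 2 * Z) :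
    Y ≤ 2 * (1 / μ + η) * Z := by
  have s5 : (1 - η) * (Y * M ^ 2) ≤ Z * (M * Z + η * M ^ 2) := by
    have h3 := mul_le_mul_of_nonneg_left h₂ (show 0 ≤ 1 - η by linarith)
    have h4 := mul_le_mul_of_nonneg_right h₁ hZ.le
    linarith
  have s6 : Y * M ^ 2 ≤ 2 * (Z * (M * Z + η * M ^ 2)) := by
    have : 0 ≤ (1 / 2 - η) * (Y * M ^ 2) := mul_nonneg (by linarith) (by positivity)
    linarith
  have s7 : Y ≤ 2 * (Z / M + η) * Z := by
    have hdiv : Z / M * M = Z := div_mul_cancel₀ Z hM.ne'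
    refine le_of_mul_le_mul_right (s6.trans (le_of_eq ?_)) (show 0 < M ^ 2 by positivity)
    linear_combination (-2 * Z * M) * hdiv
  refine s7.trans ?_
  have : Z / M ≤ 1 / μ := by
    rw [div_le_div_iff₀ hM hμ]
    linarith
  gcongr

/-- The second moment method for uniform random elements of a finite set. -/
lemma second_moment {Ω τ : Type*} (S : Finset Ω) (T : Finset τ) (E : τ → Ω → Prop)
    [∀ t, DecidablePred (E t)] {η μ : ℝ} (hη : 0 ≤ η) (hη' : η ≤ 1 / 2) (hμ : 0 < μ)
    (hind : ∀ s ∈ T, ∀ t ∈ T, s ≠ t →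
      (1 - η) * (((S.filter fun D => E s D ∧ E t D).card : ℝ) * S.card) ≤
        (S.filter (E s)).card * (S.filter (E t)).card)
    (hE : μ * S.card ≤ ∑ t ∈ T, ((S.filter (E t)).card : ℝ)) :
    ((S.filter fun D => ∀ t ∈ T, ¬ E t D).card : ℝ) ≤ 2 * (1 / μ + η) * S.card := by
  classical
  rcases S.eq_empty_or_nonempty with rfl | hS
  · simp
  set Z : ℝ := (S.card : ℝ) with hZ
  have hZ0 : 0 < Z := by rw [hZ]; exact_mod_cast hS.card_pos
  set X : Ω → ℝ := fun D => ∑ t ∈ T, if E t D then 1 else 0 with hX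
  set M : ℝ := ∑ t ∈ T, ((S.filter (E t)).card : ℝ) with hM
  have hM0 : 0 < M := lt_of_lt_of_le (by positivity) hE
  have s1 : ∑ D ∈ S, X D = M := by
    rw [hX, hM, Finset.sum_comm]
    refine Finset.sum_congr rfl fun t _ => ?_
    rw [Finset.sum_boole]
  have s2 : (1 - η) * (∑ D ∈ S, X D ^ 2) * Z ≤ M * Z + M ^ 2 := by
    have e : ∑ D ∈ S, X D ^ 2 =
        ∑ s ∈ T, ∑ t ∈ T, ((S.filter fun D => E s D ∧ E t D).card : ℝ) := by
      simp_rw [hX, sq, Finset.sum_mul_sum]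
      rw [Finset.sum_comm]
      refine Finset.sum_congr rfl fun s _ => ?_
      rw [Finset.sum_comm]
      refine Finset.sum_congr rfl fun t _ => ?_
      rw [← Finset.sum_boole]
      refine Finset.sum_congr rfl fun D _ => ?_
      by_cases h1 : E s D <;> by_cases h2 : E t D <;> simp [h1, h2]
    have e2 : M ^ 2 = ∑ s ∈ T, ∑ t ∈ T, ((S.filter (E s)).card : ℝ) * (S.filter (E t)).card := by
      rw [sq, hM, Finset.sum_mul_sum]
    have e3 : M * Z = ∑ s ∈ T, ∑ t ∈ T, if s = t then ((S.filter (E s)).card : ℝ) * Z else 0 := by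
      rw [hM, Finset.sum_mul]
      refine Finset.sum_congr rfl fun s hs => ?_
      rw [Finset.sum_ite_eq, if_pos hs]
    rw [e, e2, e3, ← Finset.sum_add_distrib, Finset.mul_sum, Finset.sum_mul]
    refine Finset.sum_le_sum fun s hs => ?_
    rw [← Finset.sum_add_distrib, Finset.mul_sum, Finset.sum_mul]
    refine Finset.sum_le_sum fun t ht => ?_
    by_cases hst : s = t
    · subst hst
      rw [if_pos rfl]
      simp only [and_self]
      have h1 : (0 : ℝ) ≤ ((S.filter (E s)).card : ℝ) := Nat.cast_nonneg _
      have h2 : 0 ≤ ((S.filter (E s)).card : ℝ) * Z := mul_nonneg h1 hZ0.le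
      nlinarith [mul_nonneg h1 h1, mul_nonneg hη h2]
    · rw [if_neg hst, zero_add, mul_assoc]
      exact hind s hs t ht hst
  have s3 : ((S.filter fun D => ∀ t ∈ T, ¬ E t D).card : ℝ) * M ^ 2 ≤
      ∑ D ∈ S, (X D * Z - M) ^ 2 := by
    rw [← nsmul_eq_mul, ← Finset.sum_const]
    refine le_trans (le_of_eq (Finset.sum_congr rfl fun D hD => ?_))
      (Finset.sum_le_sum_of_subset_of_nonneg (Finset.filter_subset _ S)
        fun D _ _ => sq_nonneg (X D * Z - M))
    have : X D = 0 := by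
      rw [hX]
      exact Finset.sum_eq_zero fun t ht => if_neg ((Finset.mem_filter.1 hD).2 t ht)
    rw [this]
    ring
  have s4 : ∑ D ∈ S, (X D * Z - M) ^ 2 = (∑ D ∈ S, X D ^ 2) * Z ^ 2 - M ^ 2 * Z := by
    have : ∀ D, (X D * Z - M) ^ 2 = X D ^ 2 * Z ^ 2 - X D * (2 * Z * M) + M ^ 2 := fun D => by ring
    simp_rw [this]
    rw [Finset.sum_add_distrib, Finset.sum_sub_distrib, ← Finset.sum_mul, ← Finset.sum_mul, s1,
      Finset.sum_const, nsmul_eq_mul, ← hZ]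
    ring
  rw [s4] at s3
  exact second_moment_arith hη' hμ hZ0 hM0 (Nat.cast_nonneg _) hE s2 s3

/-- The second moment method for the events that the numbers of pebbles on disjoint sets of
vertices are below given bounds. -/
lemma card_filter_forall_not_le_on {τ : Type*} (T : Finset τ) (A : τ → Finset V) (c : τ → V → ℕ)
    {k S : ℕ} {η μ : ℝ} (hdisj : ∀ s ∈ T, ∀ t ∈ T, s ≠ t → Disjoint (A s) (A t))
    (hcard : ∀ t, 4 * (A t).card ≤ Fintype.card V) (hV : 0 < Fintype.card V)
    (hk : ∀ t, 2 * ∑ w ∈ A t, c t w ≤ k) (hS : ∀ t, (A t).card + ∑ w ∈ A t, c t w ≤ S)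
    (hη : 2 * (S : ℝ) ^ 2 / (Fintype.card V + k - 1 : ℕ) ≤ η) (hη' : η ≤ 1 / 2) (hμ : 0 < μ)
    (hE : μ * (Finset.univ.piAntidiag k : Finset (V → ℕ)).card ≤
      ∑ t ∈ T, (((Finset.univ.piAntidiag k).filter fun D => ∀ w ∈ A t, D w ≤ c t w).card : ℝ)) :
    (((Finset.univ.piAntidiag k).filter
        fun D : V → ℕ => ∀ t ∈ T, ¬ ∀ w ∈ A t, D w ≤ c t w).card : ℝ) ≤
      2 * (1 / μ + η) * (Finset.univ.piAntidiag k : Finset (V → ℕ)).card := by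
  have hη0 : 0 ≤ η := le_trans (by positivity) hη
  have hind : ∀ s ∈ T, ∀ t ∈ T, s ≠ t → (1 - η) *
      ((((Finset.univ.piAntidiag k).filter fun D : V → ℕ =>
        (∀ w ∈ A s, D w ≤ c s w) ∧ ∀ w ∈ A t, D w ≤ c t w).card : ℝ) *
        (Finset.univ.piAntidiag k : Finset (V → ℕ)).card) ≤
      ((Finset.univ.piAntidiag k).filter fun D : V → ℕ => ∀ w ∈ A s, D w ≤ c s w).card *
      ((Finset.univ.piAntidiag k).filter fun D : V → ℕ => ∀ w ∈ A t, D w ≤ c t w).card := by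
    intro s hs t ht hst
    have h1 := hcard s
    have h2 := hcard t
    have h3 := hk s
    have h4 := hk t
    have h := card_filter_le_on_inter_le (hdisj s hs t ht hst) (c s) (c t) (k := k) (by omega)
      (by omega) (hS s) (hS t)
    rw [card_piAntidiag_nat, Finset.card_univ]
    have h5 : 1 - η ≤ 1 - 2 * (S : ℝ) ^ 2 / (Fintype.card V + k - 1 : ℕ) := by linarith
    exact le_trans (mul_le_mul_of_nonneg_right h5
      (mul_nonneg (Nat.cast_nonneg _) (Nat.cast_nonneg _))) h
  have h := second_moment (Finset.univ.piAntidiag k : Finset (V → ℕ)) T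
    (fun t D => ∀ w ∈ A t, D w ≤ c t w) hη0 hη' hμ hind hE
  exact h

end Counting

end Pebbling

/-! ### Sums over balls in the grid -/

namespace Pebbling

/-- The truncated power `max y 0 ^ p`. -/
noncomputable def truncPow (p : ℕ) (y : ℝ) : ℝ := max y 0 ^ p

lemma truncPow_nonneg (p : ℕ) (y : ℝ) : 0 ≤ truncPow p y := pow_nonneg (le_max_right _ _) p

lemma truncPow_mono (p : ℕ) {x y : ℝ} (h : x ≤ y) : truncPow p x ≤ truncPow p y :=
  pow_le_pow_left₀ (le_max_right _ _) (max_le_max_right 0 h) p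

lemma truncPow_of_nonneg (p : ℕ) {y : ℝ} (h : 0 ≤ y) : truncPow p y = y ^ p := by
  rw [truncPow, max_eq_left h]

lemma truncPow_of_nonpos {p : ℕ} (hp : p ≠ 0) {y : ℝ} (h : y ≤ 0) : truncPow p y = 0 := by
  rw [truncPow, max_eq_right h, zero_pow hp]

lemma truncPow_one (y : ℝ) : truncPow 1 y = max y 0 := by rw [truncPow, pow_one]

lemma pow_succ_sub_pow_succ_bounds {y z : ℝ} (hz : 0 ≤ z) (h : z ≤ y) (p : ℕ) :
    ((p : ℝ) + 1) * z ^ p * (y - z) ≤ y ^ (p + 1) - z ^ (p + 1) ∧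
      y ^ (p + 1) - z ^ (p + 1) ≤ ((p : ℝ) + 1) * y ^ p * (y - z) := by
  have hy : 0 ≤ y := hz.trans h
  have hyz : 0 ≤ y - z := by linarith
  induction p with
  | zero => simp
  | succ p ih =>
    have e1 : y ^ (p + 1 + 1) - z ^ (p + 1 + 1) =
        z * (y ^ (p + 1) - z ^ (p + 1)) + y ^ (p + 1) * (y - z) := by ring
    have e2 : y ^ (p + 1 + 1) - z ^ (p + 1 + 1) =
        y * (y ^ (p + 1) - z ^ (p + 1)) + z ^ (p + 1) * (y - z) := by ring
    have hpow : z ^ (p + 1) * (y - z) ≤ y ^ (p + 1) * (y - z) :=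
      mul_le_mul_of_nonneg_right (pow_le_pow_left₀ hz h _) hyz
    push_cast
    constructor
    · rw [e1]
      have := mul_le_mul_of_nonneg_left ih.1 hz
      have e : z * (((p : ℝ) + 1) * z ^ p * (y - z)) = ((p : ℝ) + 1) * z ^ (p + 1) * (y - z) := by
        ring
      linarith
    · rw [e2]
      have := mul_le_mul_of_nonneg_left ih.2 hy
      have e : y * (((p : ℝ) + 1) * y ^ p * (y - z)) = ((p : ℝ) + 1) * y ^ (p + 1) * (y - z) := by
        ring
      linarith

lemma truncPow_succ_sub_le (p : ℕ) {ℓ : ℝ} (hℓ : 0 < ℓ) (y : ℝ) :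
    truncPow (p + 1) y - truncPow (p + 1) (y - ℓ) ≤ ((p : ℝ) + 1) * ℓ * truncPow p y := by
  have h := (pow_succ_sub_pow_succ_bounds (le_max_right (y - ℓ) 0)
    (max_le_max_right 0 (show y - ℓ ≤ y by linarith)) p).2
  refine h.trans ?_
  have h2 : max y 0 - max (y - ℓ) 0 ≤ ℓ := by
    have : max y 0 ≤ max (y - ℓ) 0 + ℓ :=
      max_le (by linarith [le_max_left (y - ℓ) 0]) (by linarith [le_max_right (y - ℓ) 0])
    linarith
  have h3 : 0 ≤ ((p : ℝ) + 1) * max y 0 ^ p :=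
    mul_nonneg (by positivity) (pow_nonneg (le_max_right _ _) _)
  have := mul_le_mul_of_nonneg_left h2 h3
  rw [truncPow]
  linarith

lemma le_truncPow_succ_sub {p : ℕ} (hp : p ≠ 0) {ℓ : ℝ} (hℓ : 0 < ℓ) (y : ℝ) :
    ((p : ℝ) + 1) * ℓ * truncPow p y ≤ truncPow (p + 1) (y + ℓ) - truncPow (p + 1) y := by
  rcases le_total y 0 with hy | hy
  · rw [truncPow_of_nonpos hp hy, mul_zero]
    have := truncPow_mono (p + 1) (show y ≤ y + ℓ by linarith)
    linarith
  · have h := (pow_succ_sub_pow_succ_bounds hy (show y ≤ y + ℓ by linarith) p).1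
    rw [truncPow_of_nonneg _ hy, truncPow_of_nonneg _ hy,
      truncPow_of_nonneg _ (by linarith : (0 : ℝ) ≤ y + ℓ)]
    have e : y + ℓ - y = ℓ := by ring
    rw [e] at h
    linarith

lemma truncPow_le_sum_range (p : ℕ) {ℓ M : ℝ} (hℓ : 0 < ℓ) {ρ : ℕ} (hρ : M ≤ ρ * ℓ) :
    truncPow (p + 1) (M - ℓ) / (((p : ℝ) + 1) * ℓ) ≤
      ∑ j ∈ Finset.range ρ, truncPow p (M - ℓ * ((j : ℝ) + 1)) := by
  rw [div_le_iff₀ (by positivity), Finset.sum_mul]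
  have h := Finset.sum_le_sum fun j (_ : j ∈ Finset.range ρ) =>
    truncPow_succ_sub_le p hℓ (M - ℓ * ((j : ℝ) + 1))
  have e : ∀ j : ℕ, M - ℓ * ((j : ℝ) + 1) - ℓ = M - ℓ * (((j + 1 : ℕ) : ℝ) + 1) := by
    intro j
    push_cast
    ring
  simp_rw [e] at h
  rw [Finset.sum_range_sub' (fun j : ℕ => truncPow (p + 1) (M - ℓ * ((j : ℝ) + 1)))] at h
  rw [truncPow_of_nonpos (Nat.succ_ne_zero p)
    (show M - ℓ * ((ρ : ℝ) + 1) ≤ 0 by nlinarith)] at h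
  simp only [Nat.cast_zero, zero_add, mul_one, sub_zero] at h
  refine h.trans (le_of_eq (Finset.sum_congr rfl fun j _ => by ring))

lemma sum_range_le_truncPow {p : ℕ} (hp : p ≠ 0) {ℓ : ℝ} (hℓ : 0 < ℓ) (M : ℝ) (N : ℕ) :
    ∑ j ∈ Finset.range N, truncPow p (M - ℓ * (j : ℝ)) ≤
      truncPow (p + 1) (M + ℓ) / (((p : ℝ) + 1) * ℓ) := by
  rw [le_div_iff₀ (by positivity), Finset.sum_mul]
  have h := Finset.sum_le_sum fun j (_ : j ∈ Finset.range N) =>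
    le_truncPow_succ_sub hp hℓ (M - ℓ * (j : ℝ))
  have e : ∀ j : ℕ, M - ℓ * (j : ℝ) = M + ℓ - ℓ * ((j + 1 : ℕ) : ℝ) := by
    intro j
    push_cast
    ring
  have e' : ∀ j : ℕ, M - ℓ * (j : ℝ) + ℓ = M + ℓ - ℓ * (j : ℝ) := by
    intro j
    ring
  have h2 : ∑ j ∈ Finset.range N, (truncPow (p + 1) (M - ℓ * (j : ℝ) + ℓ) -
      truncPow (p + 1) (M - ℓ * (j : ℝ))) =
      truncPow (p + 1) (M + ℓ) - truncPow (p + 1) (M + ℓ - ℓ * (N : ℝ)) := by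
    rw [Finset.sum_congr rfl fun j _ => by rw [e' j, e j],
      Finset.sum_range_sub' (fun j : ℕ => truncPow (p + 1) (M + ℓ - ℓ * (j : ℝ)))]
    simp
  rw [h2] at h
  have h3 := truncPow_nonneg (p + 1) (M + ℓ - ℓ * (N : ℝ))
  have h4 : ∑ j ∈ Finset.range N, truncPow p (M - ℓ * (j : ℝ)) * (((p : ℝ) + 1) * ℓ) =
      ∑ j ∈ Finset.range N, ((p : ℝ) + 1) * ℓ * truncPow p (M - ℓ * (j : ℝ)) :=
    Finset.sum_congr rfl fun j _ => by ring
  linarith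

/-- `2` if there is room for `ρ` steps from `a` in both directions along one coordinate, and `1`
otherwise; in the latter case one direction has enough room when `2 * ρ ≤ n`. -/
def sides {n : ℕ} (ρ : ℕ) (a : Fin n) : ℕ := if ρ ≤ (a : ℕ) ∧ (a : ℕ) + ρ < n then 2 else 1

/-- A bound for the number of directions along one coordinate in which the grid extends from `a`:
`1` at the end `0`, and `2` elsewhere. -/
def sidesUpper {n : ℕ} (a : Fin n) : ℕ := if (a : ℕ) = 0 then 1 else 2

lemma sides_mul_le_sum {n p : ℕ} {ℓ M : ℝ} (hℓ : 0 < ℓ) {ρ : ℕ} (hρ : M ≤ ρ * ℓ) (hn : 2 * ρ ≤ n)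
    (a : Fin n) :
    (sides ρ a : ℝ) * (truncPow (p + 1) (M - ℓ) / (((p : ℝ) + 1) * ℓ)) ≤
      ∑ x : Fin n, truncPow p (M - ℓ * |((a : ℕ) : ℝ) - ((x : ℕ) : ℝ)|) := by
  rw [sum_abs_sub_eq fun y => truncPow p (M - ℓ * y)]
  have h := truncPow_le_sum_range p hℓ hρ
  set K := truncPow (p + 1) (M - ℓ) / (((p : ℝ) + 1) * ℓ)
  have hnn : ∀ s : Finset ℕ, 0 ≤ ∑ j ∈ s, truncPow p (M - ℓ * (j : ℝ)) := fun s =>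
    Finset.sum_nonneg fun _ _ => truncPow_nonneg _ _
  have hnn' : ∀ s : Finset ℕ, 0 ≤ ∑ j ∈ s, truncPow p (M - ℓ * ((j : ℝ) + 1)) := fun s =>
    Finset.sum_nonneg fun _ _ => truncPow_nonneg _ _
  have hleft : ρ ≤ (a : ℕ) →
      K ≤ ∑ j ∈ Finset.range (a : ℕ), truncPow p (M - ℓ * ((j : ℝ) + 1)) := by
    intro ha
    exact h.trans (Finset.sum_le_sum_of_subset_of_nonneg (Finset.range_mono ha)
      fun _ _ _ => truncPow_nonneg _ _)
  have hright : (a : ℕ) + ρ < n →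
      K ≤ ∑ j ∈ Finset.range (n - (a : ℕ)), truncPow p (M - ℓ * (j : ℝ)) := by
    intro ha
    refine le_trans ?_ (Finset.sum_le_sum_of_subset_of_nonneg
      (Finset.range_mono (show ρ + 1 ≤ n - (a : ℕ) by omega)) fun _ _ _ => truncPow_nonneg _ _)
    rw [Finset.sum_range_succ']
    push_cast
    have := truncPow_nonneg p (M - ℓ * 0)
    linarith
  rw [sides]
  split_ifs with hs
  · have h1 := hleft hs.1
    have h2 := hright hs.2
    push_cast
    linarith
  · push_cast
    by_cases ha : ρ ≤ (a : ℕ)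
    · have h1 := hleft ha
      have h2 := hnn (Finset.range (n - (a : ℕ)))
      linarith
    · have h1 := hright (by omega)
      have h2 := hnn' (Finset.range (a : ℕ))
      linarith

lemma sum_le_sidesUpper_mul {n p : ℕ} (hp : p ≠ 0) {ℓ : ℝ} (hℓ : 0 < ℓ) (M : ℝ) (a : Fin n) :
    ∑ x : Fin n, truncPow p (M - ℓ * |((a : ℕ) : ℝ) - ((x : ℕ) : ℝ)|) ≤
      (sidesUpper a : ℝ) * (truncPow (p + 1) (M + ℓ) / (((p : ℝ) + 1) * ℓ)) := by
  rw [sum_abs_sub_eq fun y => truncPow p (M - ℓ * y)]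
  have h1 := sum_range_le_truncPow hp hℓ M (a : ℕ)
  have h2 := sum_range_le_truncPow hp hℓ M (n - (a : ℕ))
  have h3 : ∑ j ∈ Finset.range (a : ℕ), truncPow p (M - ℓ * ((j : ℝ) + 1)) ≤
      ∑ j ∈ Finset.range (a : ℕ), truncPow p (M - ℓ * (j : ℝ)) :=
    Finset.sum_le_sum fun j _ => truncPow_mono p (by linarith)
  rw [sidesUpper]
  split_ifs with h
  · rw [h, Finset.range_zero, Finset.sum_empty]
    rw [h] at h2
    push_cast
    linarith
  · push_cast
    linarith

lemma sum_gridDist_succ {d n : ℕ} (ℓ : Fin (d + 1) → ℝ) (v : Grid (d + 1) n) (F : ℝ → ℝ) :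
    ∑ w, F (gridDist ℓ v w) = ∑ x : Fin n, ∑ w : Grid d n,
      F (ℓ 0 * |((v 0 : ℕ) : ℝ) - ((x : ℕ) : ℝ)| +
        gridDist (fun i => ℓ i.succ) (fun i => v i.succ) w) := by
  rw [← Fintype.sum_prod_type']
  refine (Fintype.sum_equiv (Fin.consEquiv fun _ => Fin n) _ _ fun z => ?_).symm
  rw [gridDist, gridDist, Fin.sum_univ_succ]
  simp [Fin.consEquiv]

/-- A lower bound for the lattice sums; the main term is the volume of a simplex, once
for every orthant that fits into the grid around `v`. -/
lemma le_sum_truncPow {d n : ℕ} {ℓ : Fin d → ℝ} (hℓ : ∀ i, 0 < ℓ i) {ρ : ℕ} (hn : 2 * ρ ≤ n)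
    (v : Grid d n) (p : ℕ) {M : ℝ} (hρ : ∀ i, M ≤ ρ * ℓ i) :
    (∏ i, (sides ρ (v i) : ℝ)) * ((p.factorial : ℝ) / ((p + d).factorial * ∏ i, ℓ i)) *
        truncPow (p + d) (M - ∑ i, ℓ i) ≤
      ∑ w, truncPow p (M - gridDist ℓ v w) := by
  induction d generalizing M with
  | zero =>
    have hne : (p.factorial : ℝ) ≠ 0 := by positivity
    simp [gridDist, div_self hne]
  | succ d ih =>
    rw [sum_gridDist_succ ℓ v fun y => truncPow p (M - y)]
    set ℓ' : Fin d → ℝ := fun i => ℓ i.succ with hℓ'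
    set v' : Grid d n := fun i => v i.succ with hv'
    have hP : (0 : ℝ) < ∏ i, ℓ' i := Finset.prod_pos fun i _ => hℓ _
    set c : ℝ := (∏ i, (sides ρ (v' i) : ℝ)) *
      ((p.factorial : ℝ) / ((p + d).factorial * ∏ i, ℓ' i)) with hc
    have hc0 : 0 ≤ c := by
      rw [hc]
      exact mul_nonneg (Finset.prod_nonneg fun _ _ => Nat.cast_nonneg _) (by positivity)
    have h1 : ∀ x : Fin n, c * truncPow (p + d)
        (M - ∑ i, ℓ' i - ℓ 0 * |((v 0 : ℕ) : ℝ) - ((x : ℕ) : ℝ)|) ≤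
        ∑ w : Grid d n, truncPow p (M - (ℓ 0 * |((v 0 : ℕ) : ℝ) - ((x : ℕ) : ℝ)| +
          gridDist ℓ' v' w)) := by
      intro x
      have := ih (ℓ := ℓ') (fun i => hℓ _) v' (M := M - ℓ 0 * |((v 0 : ℕ) : ℝ) - ((x : ℕ) : ℝ)|)
        (fun i => by
          have := hρ i.succ
          have := mul_nonneg (hℓ 0).le (abs_nonneg (((v 0 : ℕ) : ℝ) - ((x : ℕ) : ℝ)))
          show _ ≤ (ρ : ℝ) * ℓ i.succ
          linarith)
      rw [sub_right_comm]
      refine this.trans (le_of_eq (Finset.sum_congr rfl fun w _ => ?_))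
      rw [sub_sub]
    refine le_trans ?_ (Finset.sum_le_sum fun x _ => h1 x)
    rw [← Finset.mul_sum]
    have hs : 0 ≤ ∑ i, ℓ' i := Finset.sum_nonneg fun i _ => (hℓ _).le
    have h2 := sides_mul_le_sum (p := p + d) (hℓ 0)
      (show M - ∑ i, ℓ' i ≤ ρ * ℓ 0 by linarith [hρ 0]) hn (v 0)
    refine le_trans (le_of_eq ?_) (mul_le_mul_of_nonneg_left h2 hc0)
    rw [hc, Fin.prod_univ_succ, Fin.prod_univ_succ, Fin.sum_univ_succ, ← add_assoc,
      Nat.factorial_succ, sub_sub, add_comm (∑ i, ℓ' i) (ℓ 0)]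
    have := (hℓ 0).ne'
    have := hP.ne'
    have : ((p + d).factorial : ℝ) ≠ 0 := by positivity
    have : ((p : ℝ) + d + 1) ≠ 0 := by positivity
    push_cast
    simp only [hℓ', hv'] at *
    field_simp

lemma sum_truncPow_le {d n : ℕ} {ℓ : Fin d → ℝ} (hℓ : ∀ i, 0 < ℓ i)
    (v : Grid d n) {p : ℕ} (hp : p ≠ 0) (M : ℝ) :
    ∑ w, truncPow p (M - gridDist ℓ v w) ≤
      (∏ i, (sidesUpper (v i) : ℝ)) * ((p.factorial : ℝ) / ((p + d).factorial * ∏ i, ℓ i)) *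
        truncPow (p + d) (M + ∑ i, ℓ i) := by
  induction d generalizing M with
  | zero =>
    have hne : (p.factorial : ℝ) ≠ 0 := by positivity
    simp [gridDist, div_self hne]
  | succ d ih =>
    rw [sum_gridDist_succ ℓ v fun y => truncPow p (M - y)]
    set ℓ' : Fin d → ℝ := fun i => ℓ i.succ with hℓ'
    set v' : Grid d n := fun i => v i.succ with hv'
    have hP : (0 : ℝ) < ∏ i, ℓ' i := Finset.prod_pos fun i _ => hℓ _
    set c : ℝ := (∏ i, (sidesUpper (v' i) : ℝ)) *
      ((p.factorial : ℝ) / ((p + d).factorial * ∏ i, ℓ' i)) with hc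
    have hc0 : 0 ≤ c := by
      rw [hc]
      exact mul_nonneg (Finset.prod_nonneg fun _ _ => Nat.cast_nonneg _) (by positivity)
    have h1 : ∀ x : Fin n,
        ∑ w : Grid d n, truncPow p (M - (ℓ 0 * |((v 0 : ℕ) : ℝ) - ((x : ℕ) : ℝ)| +
          gridDist ℓ' v' w)) ≤ c * truncPow (p + d)
        (M + ∑ i, ℓ' i - ℓ 0 * |((v 0 : ℕ) : ℝ) - ((x : ℕ) : ℝ)|) := by
      intro x
      have := ih (ℓ := ℓ') (fun i => hℓ _) v' (M := M - ℓ 0 * |((v 0 : ℕ) : ℝ) - ((x : ℕ) : ℝ)|)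
      rw [add_sub_right_comm]
      refine le_trans (le_of_eq (Finset.sum_congr rfl fun w _ => ?_)) this
      rw [sub_sub]
    refine le_trans (Finset.sum_le_sum fun x _ => h1 x) ?_
    rw [← Finset.mul_sum]
    have h2 := sum_le_sidesUpper_mul (p := p + d) (by omega) (hℓ 0) (M + ∑ i, ℓ' i) (v 0)
    refine le_trans (mul_le_mul_of_nonneg_left h2 hc0) (le_of_eq ?_)
    rw [hc, Fin.prod_univ_succ, Fin.prod_univ_succ, Fin.sum_univ_succ, ← add_assoc p d 1,
      Nat.factorial_succ, add_assoc M, add_comm (∑ i, ℓ' i) (ℓ 0)]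
    have := (hℓ 0).ne'
    have := hP.ne'
    have : ((p + d).factorial : ℝ) ≠ 0 := by positivity
    have : ((p : ℝ) + d + 1) ≠ 0 := by positivity
    push_cast
    simp only [hℓ', hv'] at *
    field_simp

/-- The ball of radius `M` around `v`. -/
noncomputable def gridBall {d n : ℕ} (ℓ : Fin d → ℝ) (v : Grid d n) (M : ℝ) : Finset (Grid d n) :=
  Finset.univ.filter fun w => gridDist ℓ v w ≤ M

lemma mem_gridBall {d n : ℕ} {ℓ : Fin d → ℝ} {v w : Grid d n} {M : ℝ} :
    w ∈ gridBall ℓ v M ↔ gridDist ℓ v w ≤ M := by simp [gridBall]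

lemma card_gridBall_le {d n : ℕ} {ℓ : Fin d → ℝ} (hℓ : ∀ i, Real.log 2 ≤ ℓ i) (v : Grid d n)
    {M : ℝ} (hM : 0 ≤ M) : ((gridBall ℓ v M).card : ℝ) ≤ (4 * M + 1) ^ d := by
  have hl2 : (1 / 2 : ℝ) < Real.log 2 := by linarith [Real.log_two_gt_d9]
  have hℓ0 : ∀ i, 0 ≤ ℓ i := fun i => by linarith [hℓ i]
  have h1 : gridBall ℓ v M ⊆ Fintype.piFinset fun i =>
      Finset.univ.filter fun x : Fin n => |((v i : ℕ) : ℝ) - ((x : ℕ) : ℝ)| ≤ 2 * M := by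
    intro w hw
    rw [mem_gridBall] at hw
    rw [Fintype.mem_piFinset]
    intro i
    rw [Finset.mem_filter]
    refine ⟨Finset.mem_univ _, ?_⟩
    have h2 := (mul_abs_le_gridDist hℓ0 v w i).trans hw
    have h3 := hℓ i
    nlinarith [abs_nonneg (((v i : ℕ) : ℝ) - ((w i : ℕ) : ℝ))]
  refine (Nat.cast_le.2 (Finset.card_le_card h1)).trans ?_
  rw [Fintype.card_piFinset]
  push_cast
  calc _ ≤ ∏ _i : Fin d, (4 * M + 1) := by
        refine Finset.prod_le_prod (fun i _ => Nat.cast_nonneg _) fun i _ => ?_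
        rw [← Finset.sum_boole, sum_abs_sub_eq fun y => if y ≤ 2 * M then (1 : ℝ) else 0]
        have hf : (⌊2 * M⌋₊ : ℝ) ≤ 2 * M := Nat.floor_le (by linarith)
        have k1 : ∑ j ∈ Finset.range (v i : ℕ), (if (j : ℝ) + 1 ≤ 2 * M then (1 : ℝ) else 0) ≤
            2 * M := by
          rw [Finset.sum_boole]
          refine le_trans (Nat.cast_le.2 (Finset.card_le_card (t := Finset.range ⌊2 * M⌋₊) ?_)) ?_
          · intro j hj
            have hj := (Finset.mem_filter.1 hj).2
            rw [Finset.mem_range, Nat.lt_iff_add_one_le, Nat.le_floor_iff (by linarith)]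
            push_cast
            exact hj
          · rw [Finset.card_range]
            exact hf
        have k2 : ∑ j ∈ Finset.range (n - (v i : ℕ)), (if (j : ℝ) ≤ 2 * M then (1 : ℝ) else 0) ≤
            2 * M + 1 := by
          rw [Finset.sum_boole]
          refine le_trans
            (Nat.cast_le.2 (Finset.card_le_card (t := Finset.range (⌊2 * M⌋₊ + 1)) ?_)) ?_
          · intro j hj
            have hj := (Finset.mem_filter.1 hj).2
            rw [Finset.mem_range, Nat.lt_add_one_iff, Nat.le_floor_iff (by linarith)]
            exact hj
          · rw [Finset.card_range]
            push_cast
            linarith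
        linarith
    _ = _ := by simp

end Pebbling

/-! ### The scale of the threshold -/

namespace Pebbling

section Radius

variable {d : ℕ}

/-- The constant `γ` for which `γ * L ^ (d + 1)` is twice the main term of the sum of
`max (L - gridDist ℓ 0 w) 0` over an orthant. -/
noncomputable def simplexConst (ℓ : Fin d → ℝ) : ℝ := 2 / ((d + 1).factorial * ∏ i, ℓ i)

/-- The radius `L` determined by `simplexConst ℓ * L ^ (d + 1) = log n`. -/
noncomputable def radius (ℓ : Fin d → ℝ) (n : ℕ) : ℝ :=
  ((Nat.factorial (d + 1) : ℝ) * Real.log (n : ℝ) * (∏ i, ℓ i) / 2) ^ ((1 : ℝ) / ((d : ℝ) + 1))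

/-- The number of pebbles per vertex at the threshold, up to a constant factor, when the radius is
`L`. -/
noncomputable def density (d : ℕ) (L : ℝ) : ℝ := Real.exp L / L ^ d

variable {ℓ : Fin d → ℝ}

lemma simplexConst_pos (hℓ : ∀ i, 0 < ℓ i) : 0 < simplexConst ℓ := by
  have : 0 < ∏ i, ℓ i := Finset.prod_pos fun i _ => hℓ i
  rw [simplexConst]
  positivity

lemma simplexConst_mul_radius_pow (hℓ : ∀ i, 0 < ℓ i) (n : ℕ) :
    simplexConst ℓ * radius ℓ n ^ (d + 1) = Real.log n := by
  have h1 : 0 < ∏ i, ℓ i := Finset.prod_pos fun i _ => hℓ i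
  have h3 : (((1 : ℝ) / ((d : ℝ) + 1))) = ((d + 1 : ℕ) : ℝ)⁻¹ := by push_cast; rw [one_div]
  rw [radius, h3, Real.rpow_inv_natCast_pow (by positivity) (Nat.succ_ne_zero d), simplexConst]
  field_simp

lemma tendsto_radius (hℓ : ∀ i, 0 < ℓ i) : Tendsto (radius ℓ) atTop atTop := by
  have h1 : 0 < ∏ i, ℓ i := Finset.prod_pos fun i _ => hℓ i
  refine (tendsto_rpow_atTop (show 0 < (1 : ℝ) / ((d : ℝ) + 1) by positivity)).comp ?_
  have h := (Real.tendsto_log_atTop.comp tendsto_natCast_atTop_atTop).const_mul_atTop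
    (show 0 < ((d + 1).factorial : ℝ) * (∏ i, ℓ i) / 2 by positivity)
  refine h.congr fun n => ?_
  simp only [Function.comp]
  ring

lemma exp_simplexConst_mul_radius_pow (hℓ : ∀ i, 0 < ℓ i) {n : ℕ} (hn : 1 ≤ n) :
    Real.exp (simplexConst ℓ * radius ℓ n ^ (d + 1)) = n := by
  rw [simplexConst_mul_radius_pow hℓ, Real.exp_log (by exact_mod_cast hn)]

end Radius

lemma eventually_mul_pow_le_exp (C : ℝ) (a : ℕ) {b : ℝ} (hb : 0 < b) :
    ∀ᶠ L : ℝ in atTop, C * L ^ a ≤ Real.exp (b * L) := by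
  have h := (isLittleO_pow_exp_pos_mul_atTop a hb).bound
    (show 0 < 1 / (|C| + 1) by positivity)
  filter_upwards [h, eventually_ge_atTop 0] with L hL h0
  rw [Real.norm_of_nonneg (by positivity), Real.norm_of_nonneg (Real.exp_pos _).le, one_div,
    inv_mul_eq_div, le_div_iff₀ (by positivity)] at hL
  have h1 : 0 ≤ L ^ a := by positivity
  nlinarith [le_abs_self C]

lemma eventually_mul_log_pow_le (C : ℝ) (a : ℕ) :
    ∀ᶠ L : ℝ in atTop, C * Real.log L ^ a ≤ L := by
  filter_upwards [Real.tendsto_log_atTop.eventually (eventually_mul_pow_le_exp C a one_pos),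
    eventually_gt_atTop 0] with L hL h0
  rwa [one_mul, Real.exp_log h0] at hL

/-! ### Probabilities and monotonicity -/

section Prob

variable {d n : ℕ} {q : Fin d → ℕ}

lemma card_grid (d n : ℕ) : Fintype.card (Grid d n) = n ^ d := by simp

lemma card_configs (d n k : ℕ) : (configs d n k).card = (n ^ d).multichoose k := by
  rw [configs, card_piAntidiag_nat, Finset.card_univ, card_grid]

lemma card_configs_pos (hn : 1 ≤ n) (k : ℕ) : (0 : ℝ) < (configs d n k).card := by
  rw [card_configs]
  exact_mod_cast multichoose_pos (Nat.one_le_pow _ _ hn) k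

open Classical in
lemma one_sub_le_solvableProb (hn : 1 ≤ n) {k : ℕ} {ε : ℝ}
    (h : (((configs d n k).filter fun D => ¬ Solvable q D).card : ℝ) ≤ ε * (configs d n k).card) :
    1 - ε ≤ solvableProb q n k := by
  have hp := card_configs_pos (d := d) hn k
  rw [solvableProb, le_div_iff₀ hp]
  have h1 := Finset.card_filter_add_card_filter_not (s := configs d n k) (Solvable q)
  have h2 : (((configs d n k).filter fun D => Solvable q D).card : ℝ) +
      (((configs d n k).filter fun D => ¬ Solvable q D).card : ℝ) = (configs d n k).card := by
    exact_mod_cast h1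
  linarith

open Classical in
lemma solvableProb_le_of_card_le (hn : 1 ≤ n) {k : ℕ} {ε : ℝ}
    (h : (((configs d n k).filter fun D => Solvable q D).card : ℝ) ≤ ε * (configs d n k).card) :
    solvableProb q n k ≤ ε := by
  rw [solvableProb, div_le_iff₀ (card_configs_pos hn k)]
  exact h

lemma solvableProb_nonneg (q : Fin d → ℕ) (n k : ℕ) : 0 ≤ solvableProb q n k := by
  rw [solvableProb]
  positivity

lemma solvableProb_le_one (q : Fin d → ℕ) (n k : ℕ) : solvableProb q n k ≤ 1 := by
  classical
  rw [solvableProb]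
  refine div_le_one_of_le₀ ?_ (Nat.cast_nonneg _)
  exact_mod_cast Finset.card_filter_le _ _

lemma solvableProb_zero (hn : 1 ≤ n) (hq : ∀ i, 2 ≤ q i) : solvableProb q n 0 = 0 := by
  classical
  refine le_antisymm (solvableProb_le_of_card_le hn ?_) (solvableProb_nonneg q n 0)
  rw [Finset.filter_eq_empty_iff.2, Finset.card_empty, Nat.cast_zero, zero_mul]
  intro D hD
  rw [configs, Finset.piAntidiag_zero, Finset.mem_singleton] at hD
  rw [hD]
  exact not_solvable_zero hn hq

/-- Solvability becomes more likely with more pebbles: this is a double count of the pairs of a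
solvable configuration and one obtained from it by adding a pebble at `v`, weighted by the number
of pebbles that are then on `v`. -/
lemma solvableProb_mono (hn : 1 ≤ n) : Monotone (solvableProb q n) := by
  classical
  refine monotone_nat_of_le_succ fun k => ?_
  set m := n ^ d
  have hm1 : 1 ≤ m := Nat.one_le_pow _ _ hn
  set U : ℕ → Finset (Config (Grid d n)) := fun k => (configs d n k).filter fun D => Solvable q D
    with hU
  have hmem : ∀ k D, D ∈ U k ↔ ∑ w, D w = k ∧ Solvable q D := by
    intro k D
    simp [hU, configs]
  have key : (m + k) * (U k).card ≤ (k + 1) * (U (k + 1)).card := by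
    have h1 : (m + k) * (U k).card = ∑ v, ∑ D ∈ U k, (D v + 1) := by
      rw [Finset.sum_comm, Finset.sum_congr rfl (g := fun _ => m + k), Finset.sum_const,
        smul_eq_mul, mul_comm]
      intro D hD
      rw [Finset.sum_add_distrib, ((hmem k D).1 hD).1, Finset.sum_const, Finset.card_univ,
        card_grid, smul_eq_mul, mul_one, add_comm]
    have h2 : (k + 1) * (U (k + 1)).card = ∑ v, ∑ D ∈ U (k + 1), D v := by
      rw [Finset.sum_comm, Finset.sum_congr rfl (g := fun _ => k + 1), Finset.sum_const,
        smul_eq_mul, mul_comm]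
      intro D hD
      exact ((hmem _ D).1 hD).1
    rw [h1, h2]
    refine Finset.sum_le_sum fun v _ => ?_
    have hinj : Set.InjOn (fun D : Config (Grid d n) => D + Pi.single v 1) (U k : Set _) :=
      fun D _ E _ h => add_right_cancel h
    calc ∑ D ∈ U k, (D v + 1) = ∑ D ∈ (U k).image fun D => D + Pi.single v 1, D v := by
          rw [Finset.sum_image hinj]
          refine Finset.sum_congr rfl fun D _ => ?_
          simp
      _ ≤ _ := by
          refine Finset.sum_le_sum_of_subset fun D' hD' => ?_
          obtain ⟨D, hD, rfl⟩ := Finset.mem_image.1 hD'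
          rw [hmem] at hD ⊢
          refine ⟨?_, hD.2.add _⟩
          simp [Finset.sum_add_distrib, hD.1]
  have hT := succ_mul_multichoose_succ hm1 k
  rw [solvableProb, solvableProb, div_le_div_iff₀ (card_configs_pos hn k)
    (card_configs_pos hn (k + 1)), card_configs, card_configs]
  have h3 : (U k).card * m.multichoose (k + 1) ≤ (U (k + 1)).card * m.multichoose k := by
    refine Nat.le_of_mul_le_mul_left ?_ (show 0 < k + 1 by omega)
    calc (k + 1) * ((U k).card * m.multichoose (k + 1)) =
          (U k).card * ((k + 1) * m.multichoose (k + 1)) := by ring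
      _ = ((m + k) * (U k).card) * m.multichoose k := by rw [hT]; ring
      _ ≤ ((k + 1) * (U (k + 1)).card) * m.multichoose k := Nat.mul_le_mul_right _ key
      _ = _ := by ring
  exact_mod_cast h3

/-- A vertex without pebbles is needed for a configuration not to be solvable, and a given vertex
is empty with probability at most `n ^ d / (n ^ d + k)`. -/
lemma one_sub_div_le_solvableProb (hd : 1 ≤ d) (hn : 2 ≤ n) (k : ℕ) :
    1 - (n ^ d : ℝ) * ((n ^ d : ℝ) / (n ^ d + k)) ≤ solvableProb q n k := by
  classical
  refine one_sub_le_solvableProb (by omega) ?_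
  have hsub : (configs d n k).filter (fun D => ¬ Solvable q D) ⊆
      Finset.univ.biUnion fun v : Grid d n =>
        (configs d n k).filter fun D => ∀ w ∈ ({v} : Finset (Grid d n)), D w = 0 := by
    intro D hD
    rw [Finset.mem_filter] at hD
    simp only [Finset.mem_biUnion, Finset.mem_univ, true_and, Finset.mem_filter]
    by_contra hcon
    push Not at hcon
    refine hD.2 fun v => ⟨D, Relation.ReflTransGen.refl, ?_⟩
    obtain ⟨w, hw, hw0⟩ := hcon v hD.1
    rw [Finset.mem_singleton] at hw
    rw [← hw]
    omega
  refine (Nat.cast_le.2 ((Finset.card_le_card hsub).trans Finset.card_biUnion_le)).trans ?_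
  push_cast
  refine (Finset.sum_le_sum fun v _ => card_filter_eq_on_le (A := {v}) ?_ (fun _ => 0) k).trans ?_
  · rw [Finset.card_singleton, card_grid]
    exact Nat.one_lt_pow (by omega) (by omega)
  · simp only [Finset.card_singleton, pow_one]
    rw [Finset.sum_const, Finset.card_univ, card_grid, card_configs]
    simp [mul_assoc]

end Prob

end Pebbling

/-! ### The upper bound for the threshold -/

namespace Pebbling

section Upper

variable {d n : ℕ}

lemma half_min_le_one_sub_exp_neg {s : ℝ} (hs : 0 ≤ s) : min s 1 / 2 ≤ 1 - Real.exp (-s) := by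
  have h1 : Real.exp (-s) ≤ 1 / (1 + s) := by
    rw [Real.exp_neg, ← one_div]
    exact one_div_le_one_div_of_le (by linarith) (by linarith [Real.add_one_le_exp s])
  have h2 : 1 - 1 / (1 + s) = s / (1 + s) := by
    field_simp
    ring
  have h3 : min s 1 / 2 ≤ s / (1 + s) := by
    rw [div_le_div_iff₀ (by norm_num) (by linarith)]
    rcases le_total s 1 with h | h
    · rw [min_eq_left h]
      nlinarith
    · rw [min_eq_right h]
      linarith
  linarith

/-- Chernoff's bound for the weight seen from `v`, using the pebbles in a ball around `v`. -/
lemma card_weight_le {ℓ : Fin d → ℝ} {k : ℕ} (hk : 1 ≤ k) (v : Grid d n)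
    {M t : ℝ} (C : ℝ) (ht : 0 < t) (hball : (gridBall ℓ v M).card < n ^ d)
    (hM : Real.exp M ≤ (k : ℝ) / (n : ℝ) ^ d * t / 2) :
    (((configs d n k).filter fun D => weight ℓ v D ≤ C).card : ℝ) ≤
      Real.exp (t * C - ∑ w, truncPow 1 (M - gridDist ℓ v w) +
        ∑ w, truncPow 1 (Real.log t - gridDist ℓ v w)) * (configs d n k).card := by
  set A := gridBall ℓ v M with hA
  set z : Grid d n → ℝ := fun w => Real.exp (-(t * Real.exp (-gridDist ℓ v w))) with hz
  have hz1 : ∀ w, z w < 1 := fun w => by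
    rw [hz]
    exact Real.exp_lt_one_iff.2 (by have := Real.exp_pos (-gridDist ℓ v w); nlinarith)
  have hm0 : (0 : ℝ) < (n : ℝ) ^ d := by
    have : 0 < n ^ d := by omega
    exact_mod_cast this
  have hk0 : (0 : ℝ) < k := by exact_mod_cast hk
  set lam : ℝ := (k : ℝ) / (n : ℝ) ^ d with hlam
  have hlam0 : 0 < lam := by positivity
  -- Markov's inequality for the exponential of the weight
  have h1 : (((configs d n k).filter fun D => weight ℓ v D ≤ C).card : ℝ) ≤
      Real.exp (t * C) * ∑ D ∈ configs d n k, ∏ w ∈ A, z w ^ D w := by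
    rw [Finset.mul_sum, Finset.card_eq_sum_ones, Nat.cast_sum]
    refine (Finset.sum_le_sum fun D hD => ?_).trans (Finset.sum_le_sum_of_subset_of_nonneg
      (Finset.filter_subset _ _) fun D _ _ => by positivity)
    have hD := (Finset.mem_filter.1 hD).2
    have e : ∏ w ∈ A, z w ^ D w =
        Real.exp (-(t * ∑ w ∈ A, (D w : ℝ) * Real.exp (-gridDist ℓ v w))) := by
      rw [Finset.mul_sum, ← Finset.sum_neg_distrib, Real.exp_sum]
      refine Finset.prod_congr rfl fun w _ => ?_
      rw [hz, ← Real.exp_nat_mul]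
      congr 1
      ring
    have hle : ∑ w ∈ A, (D w : ℝ) * Real.exp (-gridDist ℓ v w) ≤ weight ℓ v D :=
      Finset.sum_le_sum_of_subset_of_nonneg (Finset.subset_univ A)
        fun _ _ _ => mul_nonneg (Nat.cast_nonneg _) (Real.exp_pos _).le
    rw [e, ← Real.exp_add, Nat.cast_one]
    refine Real.one_le_exp ?_
    have := mul_le_mul_of_nonneg_left (hle.trans hD) ht.le
    linarith
  have h2 : ∑ D ∈ configs d n k, ∏ w ∈ A, z w ^ D w ≤
      ((n : ℝ) ^ d / ((n : ℝ) ^ d + k)) ^ A.card * (configs d n k).card *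
        ∏ w ∈ A, ∑ j ∈ Finset.range (k + 1), z w ^ j := by
    have := sum_prod_le (A := A) (by rw [card_grid]; exact hball) k (fun w j => z w ^ j)
      (fun w j => by positivity)
    rw [card_grid] at this
    rw [card_configs]
    push_cast at this
    exact this
  have h3 : ((n : ℝ) ^ d / ((n : ℝ) ^ d + k)) ^ A.card *
      ∏ w ∈ A, ∑ j ∈ Finset.range (k + 1), z w ^ j ≤
      ∏ w ∈ A, Real.exp (-(M - gridDist ℓ v w) + truncPow 1 (Real.log t - gridDist ℓ v w)) := by
    rw [← Finset.prod_const, ← Finset.prod_mul_distrib]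
    refine Finset.prod_le_prod (fun w _ => mul_nonneg (by positivity)
      (Finset.sum_nonneg fun _ _ => by positivity)) fun w _ => ?_
    have hz1' : 0 < 1 - z w := by linarith [hz1 w]
    have g1 : ∑ j ∈ Finset.range (k + 1), z w ^ j ≤ 1 / (1 - z w) := by
      rw [le_div_iff₀ hz1', geom_sum_mul_neg]
      have : 0 ≤ z w ^ (k + 1) := by positivity
      linarith
    have g2 : (n : ℝ) ^ d / ((n : ℝ) ^ d + k) ≤ 1 / lam := by
      rw [hlam, one_div_div]
      exact div_le_div_of_nonneg_left hm0.le hk0 (by linarith)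
    refine (mul_le_mul g2 g1 (Finset.sum_nonneg fun _ _ => by positivity) (by positivity)).trans ?_
    rw [div_mul_div_comm, one_mul, div_le_iff₀ (by positivity)]
    set y := Real.log t - gridDist ℓ v w with hy
    have g3 : t * Real.exp (-gridDist ℓ v w) = Real.exp y := by
      rw [hy, sub_eq_add_neg, Real.exp_add, Real.exp_log ht]
    have g4 : min (Real.exp y) 1 = Real.exp (y - truncPow 1 y) := by
      rw [truncPow_one]
      rcases le_total y 0 with h | h
      · rw [max_eq_right h, sub_zero, min_eq_left (Real.exp_le_one_iff.2 h)]
      · rw [max_eq_left h, sub_self, Real.exp_zero, min_eq_right (Real.one_le_exp h)]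
    have g5 : Real.exp (y - truncPow 1 y) / 2 ≤ 1 - z w := by
      have := half_min_le_one_sub_exp_neg (Real.exp_pos y).le
      rw [g4] at this
      rw [hz]
      simp only [g3]
      exact this
    have g6 : Real.exp (M - gridDist ℓ v w - truncPow 1 y) ≤ lam * (1 - z w) := by
      refine le_trans ?_ (mul_le_mul_of_nonneg_left g5 hlam0.le)
      have e : Real.exp (y - truncPow 1 y) = t * Real.exp (- gridDist ℓ v w - truncPow 1 y) := by
        rw [sub_eq_add_neg y, Real.exp_add, ← g3, mul_assoc, ← Real.exp_add, sub_eq_add_neg]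
      rw [e, sub_sub, sub_eq_add_neg, Real.exp_add, neg_add', ← mul_div_assoc, ← mul_assoc]
      have := mul_le_mul_of_nonneg_right hM (Real.exp_pos (-gridDist ℓ v w - truncPow 1 y)).le
      linarith
    calc (1 : ℝ) = Real.exp (-(M - gridDist ℓ v w) + truncPow 1 y) *
          Real.exp (M - gridDist ℓ v w - truncPow 1 y) := by
            rw [← Real.exp_add, ← Real.exp_zero]
            congr 1
            ring
      _ ≤ _ := mul_le_mul_of_nonneg_left g6 (Real.exp_pos _).le
  have h4 : ∏ w ∈ A, Real.exp (-(M - gridDist ℓ v w) + truncPow 1 (Real.log t - gridDist ℓ v w)) ≤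
      Real.exp (-(∑ w, truncPow 1 (M - gridDist ℓ v w)) +
        ∑ w, truncPow 1 (Real.log t - gridDist ℓ v w)) := by
    rw [← Real.exp_sum, Finset.sum_add_distrib, Finset.sum_neg_distrib]
    refine Real.exp_le_exp.2 (add_le_add (neg_le_neg ?_) ?_)
    · refine le_of_eq ?_
      rw [← Finset.sum_subset (Finset.subset_univ A)]
      · refine Finset.sum_congr rfl fun w hw => ?_
        rw [truncPow_one, max_eq_left (sub_nonneg.2 (mem_gridBall.1 hw))]
      · intro w _ hw
        rw [hA, mem_gridBall, not_le] at hw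
        exact truncPow_of_nonpos one_ne_zero (by linarith)
    · exact Finset.sum_le_sum_of_subset_of_nonneg (Finset.subset_univ A)
        fun _ _ _ => truncPow_nonneg _ _
  calc _ ≤ Real.exp (t * C) * (((n : ℝ) ^ d / ((n : ℝ) ^ d + k)) ^ A.card * (configs d n k).card *
        ∏ w ∈ A, ∑ j ∈ Finset.range (k + 1), z w ^ j) :=
        h1.trans (mul_le_mul_of_nonneg_left h2 (Real.exp_pos _).le)
    _ = Real.exp (t * C) * (((n : ℝ) ^ d / ((n : ℝ) ^ d + k)) ^ A.card *
        ∏ w ∈ A, ∑ j ∈ Finset.range (k + 1), z w ^ j) * (configs d n k).card := by ring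
    _ ≤ Real.exp (t * C) * Real.exp (-(∑ w, truncPow 1 (M - gridDist ℓ v w)) +
        ∑ w, truncPow 1 (Real.log t - gridDist ℓ v w)) * (configs d n k).card :=
        mul_le_mul_of_nonneg_right
          (mul_le_mul_of_nonneg_left (h3.trans h4) (Real.exp_pos _).le) (Nat.cast_nonneg _)
    _ = _ := by
        rw [← Real.exp_add]
        congr 2
        ring

/-- The number of coordinates in which `v` is at distance at least `ρ` from both ends. -/
def interiorCard (ρ : ℕ) (v : Grid d n) : ℕ :=
  (Finset.univ.filter fun i => ρ ≤ (v i : ℕ) ∧ (v i : ℕ) + ρ < n).card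

lemma prod_sides (ρ : ℕ) (v : Grid d n) : ∏ i, (sides ρ (v i) : ℝ) = 2 ^ interiorCard ρ v := by
  have h : ∀ i, (sides ρ (v i) : ℝ) = if ρ ≤ (v i : ℕ) ∧ (v i : ℕ) + ρ < n then 2 else 1 := by
    intro i
    rw [sides]
    split_ifs <;> simp
  simp_rw [h, Finset.prod_ite, Finset.prod_const, one_pow, mul_one]
  rfl

/-- Vertices with `j` coordinates in the interior are rare enough that weighting them by `n ^ (-j)`
leaves only a sum that is polynomial in `ρ`. -/
lemma sum_inv_pow_interiorCard_le (hn : 1 ≤ n) (ρ : ℕ) :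
    ∑ v : Grid d n, ((n : ℝ)⁻¹) ^ interiorCard ρ v ≤ (1 + 2 * (ρ : ℝ)) ^ d := by
  have h : ∀ v : Grid d n, ((n : ℝ)⁻¹) ^ interiorCard ρ v =
      ∏ i, if ρ ≤ (v i : ℕ) ∧ (v i : ℕ) + ρ < n then (n : ℝ)⁻¹ else 1 := by
    intro v
    rw [Finset.prod_ite, Finset.prod_const, Finset.prod_const, one_pow, mul_one]
    rfl
  simp_rw [h]
  have h2 := Finset.prod_univ_sum (fun _ : Fin d => (Finset.univ : Finset (Fin n)))
    (fun _ x => if ρ ≤ (x : ℕ) ∧ (x : ℕ) + ρ < n then (n : ℝ)⁻¹ else 1)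
  rw [Fintype.piFinset_univ] at h2
  rw [← h2]
  calc _ ≤ ∏ _i : Fin d, (1 + 2 * (ρ : ℝ)) := by
        refine Finset.prod_le_prod (fun i _ => Finset.sum_nonneg fun _ _ => by positivity)
          fun i _ => ?_
        rw [Finset.sum_ite, Finset.sum_const, Finset.sum_const, nsmul_eq_mul, nsmul_eq_mul, mul_one]
        have hn0 : (0 : ℝ) < n := by exact_mod_cast hn
        have b1 : (((Finset.univ : Finset (Fin n)).filter
            fun x : Fin n => ρ ≤ (x : ℕ) ∧ (x : ℕ) + ρ < n).card : ℝ) * (n : ℝ)⁻¹ ≤ 1 := by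
          rw [← div_eq_mul_inv, div_le_one hn0]
          have := Finset.card_filter_le (Finset.univ : Finset (Fin n))
            (fun x : Fin n => ρ ≤ (x : ℕ) ∧ (x : ℕ) + ρ < n)
          rw [Finset.card_univ, Fintype.card_fin] at this
          exact_mod_cast this
        have b2 : ((Finset.univ : Finset (Fin n)).filter
            fun x : Fin n => ¬ (ρ ≤ (x : ℕ) ∧ (x : ℕ) + ρ < n)).card ≤ 2 * ρ := by
          have hc : ((Finset.univ : Finset (Fin n)).filter
              fun x : Fin n => ¬ (ρ ≤ (x : ℕ) ∧ (x : ℕ) + ρ < n)).card ≤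
              (Finset.range ρ ∪ Finset.Ico (n - ρ) n).card := by
            refine Finset.card_le_card_of_injOn (fun x => (x : ℕ)) ?_ Fin.val_injective.injOn
            intro x hx
            have hx := (Finset.mem_filter.1 hx).2
            have := x.isLt
            simp only [Finset.coe_union, Set.mem_union, Finset.mem_coe, Finset.mem_range,
              Finset.mem_Ico]
            omega
          refine hc.trans ((Finset.card_union_le _ _).trans ?_)
          rw [Finset.card_range, Nat.card_Ico]
          omega
        have b3 : (((Finset.univ : Finset (Fin n)).filter
            fun x : Fin n => ¬ (ρ ≤ (x : ℕ) ∧ (x : ℕ) + ρ < n)).card : ℝ) ≤ 2 * ρ := by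
          exact_mod_cast b2
        linarith
    _ = _ := by simp

lemma two_mul_le_two_pow (j : ℕ) : 2 * j ≤ 2 ^ j := by
  induction j with
  | zero => simp
  | succ j ih =>
    rw [pow_succ]
    rcases Nat.eq_zero_or_pos j with rfl | h
    · simp
    · omega

lemma pow_succ_add_mul_pow_le {L x : ℝ} (hL : 0 ≤ L) (hx : 0 ≤ x) (d : ℕ) :
    L ^ (d + 1) + x * L ^ d ≤ (L + x) ^ (d + 1) := by
  calc L ^ (d + 1) + x * L ^ d = L ^ d * (L + x) := by ring
    _ ≤ (L + x) ^ d * (L + x) :=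
        mul_le_mul_of_nonneg_right (pow_le_pow_left₀ hL (by linarith) d) (by linarith)
    _ = _ := by ring

/-- With many more pebbles than `n ^ d * density d L`, where `L` is the radius, a random
configuration is solvable with high probability. A vertex with `j` interior coordinates is
surrounded by at least `2 ^ j` orthants, so that it is unsolvable with probability at most about
`n ^ (-2 ^ (j - 1))`, and there are about `n ^ j` such vertices. -/
theorem exists_solvableProb_ge (hd : 1 ≤ d) {q : Fin d → ℕ} (hq : ∀ i, 2 ≤ q i) :
    ∃ C : ℝ, 0 < C ∧ ∀ ε : ℝ, 0 < ε → ∀ᶠ n : ℕ in atTop, ∀ k : ℕ,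
      C * ((n : ℝ) ^ d * density d (radius (logs q) n)) ≤ k → 1 - ε ≤ solvableProb q n k := by
  classical
  set ℓ := logs q
  have hℓ : ∀ i, 0 < ℓ i := logs_pos hq
  have hℓ2 : ∀ i, Real.log 2 ≤ ℓ i := log_two_le_logs hq
  have hl2 : (1 / 2 : ℝ) < Real.log 2 := by linarith [Real.log_two_gt_d9]
  set γ := simplexConst ℓ with hγ
  have hγ0 : 0 < γ := simplexConst_pos hℓ
  set s := ∑ i, ℓ i with hs
  have hs0 : 0 ≤ s := Finset.sum_nonneg fun i _ => (hℓ i).le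
  set C₀ := weightBound q
  have hC₀0 : 0 ≤ C₀ := weightBound_nonneg q
  -- this choice makes the gain from enlarging the radius by `K` exceed all lower order terms
  set K := s + 2 * (C₀ + 2) / γ with hK
  have hKs : 0 ≤ K - s := by rw [hK]; ring_nf; positivity
  have hγK : γ / 2 * (K - s) = C₀ + 2 := by
    rw [hK]
    field_simp
    ring
  refine ⟨2 * Real.exp K, by positivity, fun ε hε => ?_⟩
  have hrad := tendsto_radius hℓ
  have E1 := hrad.eventually (eventually_ge_atTop (max 1 (4 * K + 3)))
  have E2 := hrad.eventually (eventually_mul_pow_le_exp 10 1 hγ0)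
  have E3 := hrad.eventually (eventually_mul_log_pow_le (2 ^ d * (γ / 2) * ((d : ℝ) + 1) ^ (d + 1))
    (d + 1))
  have E4 := hrad.eventually (Real.tendsto_log_atTop.eventually (eventually_ge_atTop s))
  have E5 := hrad.eventually (eventually_mul_pow_le_exp (5 ^ d / ε) d one_pos)
  filter_upwards [E1, E2, E3, E4, E5, eventually_ge_atTop 1] with n e1 e2 e3 e4 e5 hn k hk
  have hexp := exp_simplexConst_mul_radius_pow hℓ hn
  set L := radius ℓ n with hL
  have hL1 : 1 ≤ L := (le_max_left _ _).trans e1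
  have hLK : 4 * K + 3 ≤ L := (le_max_right _ _).trans e1
  have hL0 : 0 < L := by linarith
  have hLd : L ≤ L ^ d := by
    calc L = L ^ 1 := (pow_one L).symm
      _ ≤ L ^ d := pow_le_pow_right₀ hL1 hd
  have hnL : 10 * L ≤ n := by
    rw [← hexp]
    rw [pow_one] at e2
    refine e2.trans (Real.exp_le_exp.2 (mul_le_mul_of_nonneg_left ?_ hγ0.le))
    calc L = L ^ 1 := (pow_one L).symm
      _ ≤ L ^ (d + 1) := pow_le_pow_right₀ hL1 (by omega)
  have hn0 : (0 : ℝ) < n := by exact_mod_cast hn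
  have hm0 : (0 : ℝ) < (n : ℝ) ^ d := by positivity
  set M := L + K with hM
  have hM0 : 0 ≤ M := by linarith
  set t := L ^ d with ht
  have ht0 : 0 < t := by positivity
  set ρ := ⌈2 * M⌉₊
  have hρ1 : 2 * M ≤ ρ := Nat.le_ceil _
  have hρ2 : (ρ : ℝ) < 2 * M + 1 := Nat.ceil_lt_add_one (by linarith)
  have hρn : 2 * ρ ≤ n := by
    have : (2 * (ρ : ℝ)) ≤ n := by linarith
    exact_mod_cast this
  have hk0 : (0 : ℝ) < k := lt_of_lt_of_le (by rw [density]; positivity) hk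
  have hMexp : Real.exp M ≤ (k : ℝ) / (n : ℝ) ^ d * t / 2 := by
    have h1 : 2 * Real.exp K * density d L ≤ (k : ℝ) / (n : ℝ) ^ d := by
      rw [le_div_iff₀ hm0]
      linarith
    have h2 : Real.exp M = 2 * Real.exp K * density d L * t / 2 := by
      rw [density, hM, Real.exp_add, ← ht]
      field_simp
    rw [h2]
    have := mul_le_mul_of_nonneg_right h1 ht0.le
    linarith
  have hpoint : ∀ v : Grid d n, (((configs d n k).filter fun D => weight ℓ v D ≤ C₀).card : ℝ) ≤
      ((n : ℝ)⁻¹) ^ interiorCard ρ v * Real.exp (-L) * (configs d n k).card := by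
    intro v
    have hball : (gridBall ℓ v M).card < n ^ d := by
      have h1 := card_gridBall_le hℓ2 v hM0
      have h2 : (4 * M + 1) ^ d < (n : ℝ) ^ d :=
        pow_lt_pow_left₀ (by linarith) (by linarith) (by omega)
      exact_mod_cast h1.trans_lt h2
    have hk1 : 1 ≤ k := by exact_mod_cast hk0
    refine (card_weight_le hk1 v C₀ ht0 hball hMexp).trans
      (mul_le_mul_of_nonneg_right ?_ (Nat.cast_nonneg _))
    have hconst : ((1 : ℕ).factorial : ℝ) / ((1 + d).factorial * ∏ i, ℓ i) = γ / 2 := by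
      rw [hγ, simplexConst, add_comm 1 d, Nat.factorial_one, Nat.cast_one]
      ring
    set j := interiorCard ρ v with hj
    -- the main term
    have k1 : (j : ℝ) * Real.log n + (C₀ + 2) * L ^ d ≤ ∑ w, truncPow 1 (M - gridDist ℓ v w) := by
      have h := le_sum_truncPow hℓ hρn v 1 (M := M) (fun i => by
        have := hℓ2 i
        have : (0 : ℝ) ≤ ρ := Nat.cast_nonneg _
        nlinarith)
      rw [prod_sides, hconst, add_comm 1 d, ← hs, ← hj,
        truncPow_of_nonneg _ (by linarith : 0 ≤ M - s)] at h
      refine le_trans ?_ h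
      have h1 := pow_succ_add_mul_pow_le hL0.le hKs d
      rw [show L + (K - s) = M - s by rw [hM]; ring] at h1
      have h2 : (2 : ℝ) * j ≤ 2 ^ j := by exact_mod_cast two_mul_le_two_pow j
      have h3 : (1 : ℝ) ≤ 2 ^ j := one_le_pow₀ (by norm_num)
      have h4 := simplexConst_mul_radius_pow hℓ n
      rw [← hL, ← hγ] at h4
      calc (j : ℝ) * Real.log n + (C₀ + 2) * L ^ d
          = (2 * (j : ℝ)) * (Real.log n / 2) + 1 * ((C₀ + 2) * L ^ d) := by ring
        _ ≤ 2 ^ j * (Real.log n / 2) + 2 ^ j * ((C₀ + 2) * L ^ d) := by gcongr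
        _ = 2 ^ j * (γ / 2) * (L ^ (d + 1) + (K - s) * L ^ d) := by
            rw [← h4, ← hγK]
            ring
        _ ≤ _ := mul_le_mul_of_nonneg_left h1 (by positivity)
    -- the lower order term
    have k2 : ∑ w, truncPow 1 (Real.log t - gridDist ℓ v w) ≤ L := by
      have h := sum_truncPow_le hℓ v one_ne_zero (Real.log t)
      rw [hconst, add_comm 1 d, ← hs] at h
      refine h.trans (le_trans ?_ e3)
      have hlog : 0 ≤ Real.log L := Real.log_nonneg hL1
      have h1 : ∏ i, (sidesUpper (v i) : ℝ) ≤ 2 ^ d := by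
        calc _ ≤ ∏ _i : Fin d, (2 : ℝ) := by
              refine Finset.prod_le_prod (fun _ _ => Nat.cast_nonneg _) fun i _ => ?_
              rw [sidesUpper]
              split_ifs <;> norm_num
          _ = _ := by simp
      have h2 : truncPow (d + 1) (Real.log t + s) ≤ (((d : ℝ) + 1) * Real.log L) ^ (d + 1) := by
        rw [ht, Real.log_pow, truncPow_of_nonneg _ (by positivity)]
        exact pow_le_pow_left₀ (by positivity) (by linarith) _
      calc _ ≤ 2 ^ d * (γ / 2) * (((d : ℝ) + 1) * Real.log L) ^ (d + 1) := by
            refine mul_le_mul (mul_le_mul_of_nonneg_right h1 (by positivity)) h2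
              (truncPow_nonneg _ _) (by positivity)
        _ = _ := by rw [mul_pow]; ring
    have e : ((n : ℝ)⁻¹) ^ j = Real.exp (-(j * Real.log n)) := by
      rw [← mul_neg, Real.exp_nat_mul, Real.exp_neg, Real.exp_log hn0]
    rw [e, ← Real.exp_add]
    refine Real.exp_le_exp.2 ?_
    rw [← ht] at k1
    linarith
  refine one_sub_le_solvableProb hn ?_
  have hsub : (configs d n k).filter (fun D => ¬ Solvable q D) ⊆
      Finset.univ.biUnion fun v : Grid d n =>
        (configs d n k).filter fun D => weight ℓ v D ≤ C₀ := by
    intro D hD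
    rw [Finset.mem_filter] at hD
    simp only [Finset.mem_biUnion, Finset.mem_univ, true_and, Finset.mem_filter]
    by_contra hcon
    push Not at hcon
    exact hD.2 fun v => solvableAt_of_weightBound_lt hq v D (hcon v hD.1)
  refine (Nat.cast_le.2 ((Finset.card_le_card hsub).trans Finset.card_biUnion_le)).trans ?_
  push_cast
  refine (Finset.sum_le_sum fun v _ => hpoint v).trans ?_
  rw [← Finset.sum_mul, ← Finset.sum_mul]
  refine mul_le_mul_of_nonneg_right ?_ (Nat.cast_nonneg _)
  have h1 := sum_inv_pow_interiorCard_le (d := d) hn ρ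
  have h2 : (1 + 2 * (ρ : ℝ)) ^ d ≤ 5 ^ d * L ^ d := by
    rw [← mul_pow]
    exact pow_le_pow_left₀ (by positivity) (by linarith) d
  rw [one_mul, div_mul_eq_mul_div, div_le_iff₀ hε] at e5
  calc _ ≤ (5 ^ d * L ^ d) * Real.exp (-L) :=
        mul_le_mul_of_nonneg_right (h1.trans h2) (Real.exp_pos _).le
    _ ≤ (Real.exp L * ε) * Real.exp (-L) := mul_le_mul_of_nonneg_right e5 (Real.exp_pos _).le
    _ = ε := by
        rw [Real.exp_neg]
        field_simp

end Upper

end Pebbling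

/-! ### The lower bound for the threshold -/

namespace Pebbling

section Lower

variable {d n : ℕ}

/-- The largest numbers of pebbles allowed around `v` in the events of the second moment argument:
a pebble count `D w ≤ cutoff ℓ v θ lam w` contributes at most `θ` to the weight seen from `v`,
and it is also at most the average `lam`. -/
noncomputable def cutoff (ℓ : Fin d → ℝ) (v : Grid d n) (θ lam : ℝ) (w : Grid d n) : ℕ :=
  ⌊min (θ * Real.exp (gridDist ℓ v w)) lam⌋₊

lemma sum_cutoff_le (ℓ : Fin d → ℝ) (v : Grid d n) (θ : ℝ) {lam : ℝ} (hlam : 0 ≤ lam)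
    (A : Finset (Grid d n)) : ∑ w ∈ A, (cutoff ℓ v θ lam w : ℝ) ≤ A.card * lam := by
  rw [← nsmul_eq_mul]
  refine Finset.sum_le_card_nsmul _ _ _ fun w _ => ?_
  exact (Nat.cast_le.2 (Nat.floor_le_floor (min_le_right _ _))).trans (Nat.floor_le hlam)

/-- Far from `v`, a bound on all numbers of pebbles is enough to control the weight. -/
lemma weight_lt_one_of_le_cutoff {ℓ : Fin d → ℝ} (hℓ : ∀ i, Real.log 2 ≤ ℓ i) (v : Grid d n)
    {R θ lam B : ℝ} (hθ : 0 ≤ θ) (hlam : 0 ≤ lam) (hθA : θ * (gridBall ℓ v R).card ≤ 1 / 2)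
    (hB0 : 0 ≤ B) (hB : B * Real.exp (-(R / 2)) * 8 ^ d < 1 / 2) {D : Config (Grid d n)}
    (hD : ∀ w ∈ gridBall ℓ v R, D w ≤ cutoff ℓ v θ lam w) (hDB : ∀ w, (D w : ℝ) ≤ B) :
    weight ℓ v D < 1 := by
  classical
  rw [weight, ← Finset.sum_add_sum_compl (gridBall ℓ v R)]
  have h1 : ∑ w ∈ gridBall ℓ v R, (D w : ℝ) * Real.exp (-gridDist ℓ v w) ≤ 1 / 2 := by
    refine le_trans (Finset.sum_le_card_nsmul _ _ θ fun w hw => ?_) ?_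
    · have h : (D w : ℝ) ≤ θ * Real.exp (gridDist ℓ v w) := by
        refine (Nat.cast_le.2 (hD w hw)).trans ?_
        have : 0 ≤ θ * Real.exp (gridDist ℓ v w) := by positivity
        exact (Nat.floor_le (le_min this hlam)).trans (min_le_left _ _)
      calc _ ≤ θ * Real.exp (gridDist ℓ v w) * Real.exp (-gridDist ℓ v w) :=
            mul_le_mul_of_nonneg_right h (Real.exp_pos _).le
        _ = θ := by rw [mul_assoc, ← Real.exp_add, add_neg_cancel, Real.exp_zero, mul_one]
    · rw [nsmul_eq_mul, mul_comm]
      exact hθA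
  have h2 : ∑ w ∈ (gridBall ℓ v R)ᶜ, (D w : ℝ) * Real.exp (-gridDist ℓ v w) < 1 / 2 := by
    refine lt_of_le_of_lt ?_ hB
    calc _ ≤ ∑ w ∈ (gridBall ℓ v R)ᶜ, B * Real.exp (-(R / 2)) *
            Real.exp (-(gridDist ℓ v w / 2)) := by
          refine Finset.sum_le_sum fun w hw => ?_
          rw [Finset.mem_compl, mem_gridBall, not_le] at hw
          rw [mul_assoc, ← Real.exp_add]
          exact mul_le_mul (hDB w) (Real.exp_le_exp.2 (by linarith)) (Real.exp_pos _).le hB0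
      _ ≤ ∑ w, B * Real.exp (-(R / 2)) * Real.exp (-(gridDist ℓ v w / 2)) :=
          Finset.sum_le_sum_of_subset_of_nonneg (Finset.subset_univ _) fun _ _ _ => by positivity
      _ ≤ _ := by
          rw [← Finset.mul_sum]
          exact mul_le_mul_of_nonneg_left (sum_exp_gridDist_le hℓ v) (by positivity)
  linarith

lemma exp_neg_two_mul_le {u : ℝ} (h0 : 0 ≤ u) (h1 : u ≤ 1 / 2) :
    Real.exp (-(2 * u)) ≤ 1 - u := by
  have h : Real.exp (-(2 * u)) ≤ 1 / (1 + 2 * u) := by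
    rw [Real.exp_neg, ← one_div]
    exact one_div_le_one_div_of_le (by linarith) (by linarith [Real.add_one_le_exp (2 * u)])
  refine h.trans ?_
  rw [div_le_iff₀ (by linarith)]
  nlinarith

/-- A lower bound for the probability that the numbers of pebbles around `v` are below the
cutoffs. -/
lemma le_card_cutoff {ℓ : Fin d → ℝ} (v : Grid d n) {k N : ℕ} {θ lam M R : ℝ}
    (hN : (gridBall ℓ v R).card = N)
    (hn : 1 ≤ n) (hlam : lam = (k : ℝ) / (n : ℝ) ^ d) (hlam4 : 4 ≤ lam)
    (hM : lam ≤ θ * Real.exp M) (hNm : 4 * (N : ℝ) ≤ (n : ℝ) ^ d)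
    (hNlam : (N : ℝ) * lam ≤ (n : ℝ) ^ d) :
    Real.exp (-(6 * (N : ℝ)) - ∑ w, truncPow 1 (M - gridDist ℓ v w)) * (configs d n k).card ≤
      ((configs d n k).filter fun D => ∀ w ∈ gridBall ℓ v R, D w ≤ cutoff ℓ v θ lam w).card := by
  set A := gridBall ℓ v R
  set m : ℝ := (n : ℝ) ^ d with hm
  have hm0 : 0 < m := by positivity
  have hlam0 : 0 < lam := by linarith
  have hk : (k : ℝ) = lam * m := by rw [hlam]; field_simp
  have hAm : A.card < Fintype.card (Grid d n) := by
    rw [card_grid, hN]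
    have : (N : ℝ) < (n : ℝ) ^ d := by linarith
    exact_mod_cast this
  set S := ⌊(N : ℝ) * lam⌋₊ with hS
  have hSle : (S : ℝ) ≤ N * lam := Nat.floor_le (by positivity)
  have hc : ∑ w ∈ A, cutoff ℓ v θ lam w ≤ S := by
    rw [hS, Nat.le_floor_iff (by positivity), ← hN]
    push_cast
    exact sum_cutoff_le ℓ v θ hlam0.le A
  have hSk : S ≤ k := by
    have : (S : ℝ) ≤ k := by
      refine hSle.trans ?_
      rw [hk, mul_comm]
      exact mul_le_mul_of_nonneg_left (by linarith) hlam0.le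
    exact_mod_cast this
  have key := card_filter_le_on_ge hAm (cutoff ℓ v θ lam) hc hSk
  rw [card_grid] at key
  push_cast at key
  rw [hN, ← hm] at key
  rw [card_configs]
  refine le_trans (mul_le_mul_of_nonneg_right ?_ (Nat.cast_nonneg _)) key
  -- the vertices off the ball
  have h1 : Real.exp (-(4 * (N : ℝ))) ≤ (((k : ℝ) - S) / (m + k)) ^ S := by
    set u := 1 / lam + N / m with hu
    have hu0 : 0 ≤ u := by positivity
    have hu1 : u ≤ 1 / 2 := by
      have a1 : 1 / lam ≤ 1 / 4 := one_div_le_one_div_of_le (by norm_num) hlam4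
      have a2 : N / m ≤ 1 / 4 := by rw [div_le_iff₀ hm0]; linarith
      linarith
    have huk : u * k = m + N * lam := by
      rw [hu, hk]
      field_simp
    have h2 : 1 - u ≤ ((k : ℝ) - S) / (m + k) := by
      rw [le_div_iff₀ (by linarith)]
      have : 0 ≤ u * m := by positivity
      linarith
    refine le_trans ?_ (pow_le_pow_left₀ (Real.exp_pos _).le
      ((exp_neg_two_mul_le hu0 hu1).trans h2) S)
    rw [← Real.exp_nat_mul]
    refine Real.exp_le_exp.2 ?_
    have h3 : (S : ℝ) * u ≤ 2 * N := by
      calc (S : ℝ) * u ≤ (N * lam) * u := mul_le_mul_of_nonneg_right hSle hu0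
        _ = N + N * lam * (N / m) := by
            rw [hu]
            field_simp
        _ ≤ N + m * (N / m) := by gcongr
        _ = 2 * N := by
            field_simp
            ring
    linarith
  have h2 : (Real.exp (-2) / lam) ^ N ≤ ((m - (N : ℝ)) / (m + k)) ^ N := by
    refine pow_le_pow_left₀ (by positivity) ?_ N
    have h3 : Real.exp (-2) ≤ 1 / 4 := by
      have e1 : Real.exp (-2) = Real.exp (-1) ^ 2 := by
        rw [← Real.exp_nat_mul]
        norm_num
      have e2 := Real.exp_neg_one_lt_half
      rw [e1]
      nlinarith [Real.exp_pos (-1)]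
    calc Real.exp (-2) / lam ≤ (1 / 4) / lam := div_le_div_of_nonneg_right h3 hlam0.le
      _ ≤ (m - (N : ℝ)) / (m + k) := by
          rw [div_le_div_iff₀ hlam0 (by linarith), hk]
          nlinarith
  have h3 : ∏ w ∈ A, (lam * Real.exp (-truncPow 1 (M - gridDist ℓ v w))) ≤
      ∏ w ∈ A, ((cutoff ℓ v θ lam w : ℝ) + 1) := by
    refine Finset.prod_le_prod (fun w _ => by positivity) fun w _ => ?_
    refine le_trans (le_min ?_ ?_) (Nat.lt_floor_add_one _).le
    · rw [truncPow_one]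
      calc _ ≤ (θ * Real.exp M) * Real.exp (-(M - gridDist ℓ v w)) :=
            mul_le_mul hM (Real.exp_le_exp.2 (neg_le_neg (le_max_left _ _))) (Real.exp_pos _).le
              (hlam0.le.trans hM)
        _ = _ := by
            rw [mul_assoc, ← Real.exp_add]
            congr 2
            ring
    · have : Real.exp (-truncPow 1 (M - gridDist ℓ v w)) ≤ 1 :=
        Real.exp_le_one_iff.2 (neg_nonpos.2 (truncPow_nonneg _ _))
      nlinarith
  have h4 : Real.exp (-∑ w, truncPow 1 (M - gridDist ℓ v w)) * lam ^ N ≤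
      ∏ w ∈ A, (lam * Real.exp (-truncPow 1 (M - gridDist ℓ v w))) := by
    rw [Finset.prod_mul_distrib, Finset.prod_const, hN, ← Real.exp_sum, Finset.sum_neg_distrib,
      mul_comm]
    refine mul_le_mul_of_nonneg_left (Real.exp_le_exp.2 (neg_le_neg ?_)) (by positivity)
    exact Finset.sum_le_sum_of_subset_of_nonneg (Finset.subset_univ A)
      fun _ _ _ => truncPow_nonneg _ _
  have hprod0 : 0 ≤ ∏ w ∈ A, ((cutoff ℓ v θ lam w : ℝ) + 1) :=
    Finset.prod_nonneg fun _ _ => by positivity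
  calc Real.exp (-(6 * (N : ℝ)) - ∑ w, truncPow 1 (M - gridDist ℓ v w))
      = (Real.exp (-∑ w, truncPow 1 (M - gridDist ℓ v w)) * lam ^ N) *
        ((Real.exp (-2) / lam) ^ N * Real.exp (-(4 * (N : ℝ)))) := by
        rw [div_pow, ← Real.exp_nat_mul]
        have : lam ^ N ≠ 0 := by positivity
        field_simp
        rw [← Real.exp_add, ← Real.exp_add]
        congr 1
        ring
    _ ≤ _ := by
        refine mul_le_mul (h4.trans h3) (mul_le_mul h2 h1 (Real.exp_pos _).le ?_)
          (by positivity) hprod0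
        exact le_trans (by positivity) h2

/-- With high probability no vertex has many more pebbles than the average. -/
lemma card_exists_ge_le (hn : 2 ≤ n) (hd : 1 ≤ d) {k r : ℕ} (hk : n ^ d ≤ k)
    (hr : 8 * ((k : ℝ) / (n : ℝ) ^ d) * Real.log ((n : ℝ) ^ d) ≤ r) :
    (((configs d n k).filter fun D => ∃ w, r ≤ D w).card : ℝ) ≤
      ((n : ℝ) ^ d)⁻¹ * (configs d n k).card := by
  classical
  have hm2 : 2 ≤ n ^ d := hn.trans (Nat.le_self_pow (by omega) n)
  have hm2' : (2 : ℝ) ≤ (n : ℝ) ^ d := by exact_mod_cast hm2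
  have hk' : (n : ℝ) ^ d ≤ k := by exact_mod_cast hk
  have hsub : (configs d n k).filter (fun D => ∃ w, r ≤ D w) ⊆
      Finset.univ.biUnion fun w : Grid d n => (configs d n k).filter fun D => r ≤ D w := by
    intro D hD
    rw [Finset.mem_filter] at hD
    obtain ⟨hD, w, hw⟩ := hD
    simp only [Finset.mem_biUnion, Finset.mem_univ, true_and, Finset.mem_filter]
    exact ⟨w, hD, hw⟩
  refine (Nat.cast_le.2 ((Finset.card_le_card hsub).trans Finset.card_biUnion_le)).trans ?_
  push_cast
  refine (Finset.sum_le_sum fun w _ => card_filter_ge_le (by rw [card_grid]; omega) w r k).trans ?_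
  rw [Finset.sum_const, Finset.card_univ, card_grid, card_configs, nsmul_eq_mul]
  push_cast
  rw [← mul_assoc]
  refine mul_le_mul_of_nonneg_right ?_ (Nat.cast_nonneg _)
  set m : ℝ := (n : ℝ) ^ d
  have hm0 : 0 < m := by linarith
  have hk0 : (0 : ℝ) < k := by linarith
  have hX : ((n ^ d + k - 1 : ℕ) : ℝ) = m + k - 1 := by
    rw [Nat.cast_sub (by omega)]
    push_cast
    rfl
  rw [hX]
  have h1 : (k : ℝ) / (m + k - 1) ≤ Real.exp (-(m / (4 * k))) := by
    refine le_trans ?_ (Real.one_sub_le_exp_neg _)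
    rw [div_le_iff₀ (by linarith)]
    have e : (1 - m / (4 * k)) * (m + k - 1) = m + k - 1 - m * ((m + k - 1) / (4 * k)) := by
      field_simp
    have h2 : (m + k - 1) / (4 * k) ≤ 1 / 2 := by
      rw [div_le_iff₀ (by positivity)]
      linarith
    rw [e]
    nlinarith
  have h2 : ((k : ℝ) / (m + k - 1)) ^ r ≤ m⁻¹ ^ 2 := by
    have hb : (0 : ℝ) ≤ (k : ℝ) / (m + k - 1) := div_nonneg hk0.le (by linarith)
    refine (pow_le_pow_left₀ hb h1 r).trans ?_
    rw [← Real.exp_nat_mul, ← Real.exp_log (inv_pos.2 hm0), ← Real.exp_nat_mul, Real.log_inv]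
    refine Real.exp_le_exp.2 ?_
    have h3 : 2 * Real.log m ≤ r * (m / (4 * k)) := by
      calc 2 * Real.log m = (8 * ((k : ℝ) / m) * Real.log m) * (m / (4 * k)) := by
            field_simp
            ring
        _ ≤ _ := mul_le_mul_of_nonneg_right hr (by positivity)
    push_cast
    linarith
  calc _ ≤ m * m⁻¹ ^ 2 := mul_le_mul_of_nonneg_left h2 hm0.le
    _ = m⁻¹ := by field_simp

/-- The vertex at position `a` on an edge of the grid. The remainder makes it total in `a`. -/
def edgePoint (d : ℕ) {n : ℕ} (hn : 0 < n) (a : ℕ) : Grid d n :=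
  fun i => if (i : ℕ) = 0 then ⟨a % n, Nat.mod_lt _ hn⟩ else ⟨0, hn⟩

lemma prod_sidesUpper_edgePoint_le (hn : 0 < n) (a : ℕ) :
    ∏ i, (sidesUpper (edgePoint d hn a i) : ℝ) ≤ 2 := by
  cases d with
  | zero => simp
  | succ d =>
    rw [Fin.prod_univ_succ, Finset.prod_eq_one]
    · rw [mul_one, sidesUpper]
      split_ifs <;> norm_num
    · intro i _
      simp [sidesUpper, edgePoint]

lemma half_mul_abs_le_gridDist_edgePoint {ℓ : Fin d → ℝ} (hd : 1 ≤ d)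
    (hℓ : ∀ i, Real.log 2 ≤ ℓ i) (hn : 0 < n) {a b : ℕ} (ha : a < n) (hb : b < n) :
    |(a : ℝ) - b| / 2 ≤ gridDist ℓ (edgePoint d hn a) (edgePoint d hn b) := by
  have hl2 : (1 / 2 : ℝ) < Real.log 2 := by linarith [Real.log_two_gt_d9]
  have h := mul_abs_le_gridDist (ℓ := ℓ) (fun i => by linarith [hℓ i])
    (edgePoint d hn a) (edgePoint d hn b)
    ⟨0, hd⟩
  simp only [edgePoint, if_true, Nat.mod_eq_of_lt ha, Nat.mod_eq_of_lt hb] at h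
  have := hℓ ⟨0, hd⟩
  nlinarith [abs_nonneg ((a : ℝ) - b)]

lemma sub_pow_succ_le {L x : ℝ} (hx : 0 ≤ x) (hxL : x ≤ L) (d : ℕ) :
    (L - x) ^ (d + 1) ≤ L ^ (d + 1) - x * L ^ d := by
  calc (L - x) ^ (d + 1) = (L - x) ^ d * (L - x) := by ring
    _ ≤ L ^ d * (L - x) :=
        mul_le_mul_of_nonneg_right (pow_le_pow_left₀ (by linarith) (by linarith) d) (by linarith)
    _ = _ := by ring

end Lower

end Pebbling

namespace Pebbling

section LowerBound

variable {d n : ℕ}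

/-- The second moment method applied to the balls around equally spaced points of an edge. -/
lemma card_solvable_le {q : Fin d → ℕ} (hq : ∀ i, 2 ≤ q i) (hd : 1 ≤ d) (hn : 2 ≤ n)
    {k s τ : ℕ} {θ lam R P η E : ℝ} {S : ℕ} (hk : n ^ d ≤ k) (hlam : lam = (k : ℝ) / (n : ℝ) ^ d)
    (hθ : 0 ≤ θ) (hR0 : 0 ≤ R) (hs : 4 * R < s) (hτ : τ * s ≤ n)
    (hθA : ∀ v : Grid d n, θ * (gridBall (logs q) v R).card ≤ 1 / 2)
    (hfar : 8 * lam * Real.log ((n : ℝ) ^ d) * Real.exp (-(R / 2)) * 8 ^ d < 1 / 2)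
    (hcard : ∀ v : Grid d n, 4 * ((gridBall (logs q) v R).card : ℝ) ≤ (n : ℝ) ^ d)
    (hS : ∀ v : Grid d n,
      ((gridBall (logs q) v R).card : ℝ) + (gridBall (logs q) v R).card * lam ≤ S)
    (hη : 2 * (S : ℝ) ^ 2 / (n ^ d + k - 1 : ℕ) ≤ η) (hη' : η ≤ 1 / 2)
    (hE : 0 < E) (hP : E ≤ τ * P)
    (hsingle : ∀ a, P * (configs d n k).card ≤
      ((configs d n k).filter fun D => ∀ w ∈ gridBall (logs q) (edgePoint d (by omega : 0 < n) a) R,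
        D w ≤ cutoff (logs q) (edgePoint d (by omega : 0 < n) a) θ lam w).card) :
    solvableProb q n k ≤ 2 * (1 / E + η) + ((n : ℝ) ^ d)⁻¹ := by
  classical
  have hn0 : 0 < n := by omega
  set ℓ := logs q
  have hℓ0 : ∀ i, 0 < ℓ i := logs_pos hq
  have hℓ2 : ∀ i, Real.log 2 ≤ ℓ i := log_two_le_logs hq
  have hlam0 : 0 ≤ lam := by rw [hlam]; positivity
  have hkm : (k : ℝ) = lam * (n : ℝ) ^ d := by rw [hlam]; field_simp
  have hlog0 : 0 ≤ Real.log ((n : ℝ) ^ d) :=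
    Real.log_nonneg (one_le_pow₀ (by exact_mod_cast (show 1 ≤ n by omega)))
  set v : ℕ → Grid d n := fun t => edgePoint d hn0 (t * s)
  set Ev : ℕ → Config (Grid d n) → Prop := fun t D =>
    ∀ w ∈ gridBall ℓ (v t) R, D w ≤ cutoff ℓ (v t) θ lam w with hEv
  set B := 8 * lam * Real.log ((n : ℝ) ^ d) with hB
  have hB0 : 0 ≤ B := by positivity
  set r := ⌊B⌋₊ + 1 with hr
  have hsum : ∀ t, ∑ w ∈ gridBall ℓ (v t) R, (cutoff ℓ (v t) θ lam w : ℝ) ≤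
      (gridBall ℓ (v t) R).card * lam := fun t => sum_cutoff_le ℓ (v t) θ hlam0 _
  have hdisj : ∀ a ∈ Finset.range τ, ∀ b ∈ Finset.range τ, a ≠ b →
      Disjoint (gridBall ℓ (v a) R) (gridBall ℓ (v b) R) := by
    intro a ha b hb hab
    rw [Finset.disjoint_left]
    intro w hwa hwb
    rw [mem_gridBall] at hwa hwb
    have hs0 : 0 < s := by
      have : (0 : ℝ) < s := by linarith
      exact_mod_cast this
    have hlt : ∀ a ∈ Finset.range τ, a * s < n := fun a ha =>
      (Nat.mul_lt_mul_of_pos_right (Finset.mem_range.1 ha) hs0).trans_le hτ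
    have h1 := half_mul_abs_le_gridDist_edgePoint hd hℓ2 hn0 (hlt a ha) (hlt b hb)
    have h2 := gridDist_triangle (fun i => (hℓ0 i).le) (v a) w (v b)
    rw [gridDist_comm w] at h2
    have h3 : (1 : ℝ) ≤ |(a : ℝ) - b| := by
      have : (1 : ℤ) ≤ |(a : ℤ) - b| := Int.one_le_abs (sub_ne_zero.2 (by exact_mod_cast hab))
      exact_mod_cast this
    have h4 : |((a * s : ℕ) : ℝ) - (b * s : ℕ)| = |(a : ℝ) - b| * s := by
      push_cast
      rw [← sub_mul, abs_mul, Nat.abs_cast]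
    rw [h4] at h1
    have h5 : (s : ℝ) ≤ |(a : ℝ) - b| * s := le_mul_of_one_le_left (Nat.cast_nonneg _) h3
    change |(a : ℝ) - b| * s / 2 ≤ gridDist ℓ (v a) (v b) at h1
    linarith
  have hsm := card_filter_forall_not_le_on (Finset.range τ) (fun t => gridBall ℓ (v t) R)
    (fun t => cutoff ℓ (v t) θ lam) (k := k) (S := S) (η := η) (μ := E) hdisj
    (fun t => by
      rw [card_grid]
      exact_mod_cast hcard (v t))
    (by rw [card_grid]; positivity)
    (fun t => by
      have : 2 * ∑ w ∈ gridBall ℓ (v t) R, (cutoff ℓ (v t) θ lam w : ℝ) ≤ k := by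
        rw [hkm]
        nlinarith [hsum t, hcard (v t)]
      exact_mod_cast this)
    (fun t => by
      have : ((gridBall ℓ (v t) R).card : ℝ) +
        ∑ w ∈ gridBall ℓ (v t) R, (cutoff ℓ (v t) θ lam w : ℝ) ≤ S := by
        linarith [hS (v t), hsum t]
      exact_mod_cast this)
    (by rw [card_grid]; exact hη) hη' hE
    (by
      have h := Finset.card_nsmul_le_sum (Finset.range τ) _ (P * (configs d n k).card)
        (fun t _ => hsingle (t * s))
      rw [Finset.card_range, nsmul_eq_mul, ← mul_assoc] at h
      exact le_trans (mul_le_mul_of_nonneg_right hP (Nat.cast_nonneg _)) h)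
  have htail := card_exists_ge_le (r := r) hn hd hk (by
    rw [← hlam, ← hB, hr]
    push_cast
    exact (Nat.lt_floor_add_one B).le)
  refine solvableProb_le_of_card_le (by omega) ?_
  have hsub : (configs d n k).filter (fun D => Solvable q D) ⊆
      (configs d n k).filter (fun D => ∀ t ∈ Finset.range τ, ¬ Ev t D) ∪
        (configs d n k).filter (fun D => ∃ w, r ≤ D w) := by
    intro D hD
    rw [Finset.mem_filter] at hD
    rw [Finset.mem_union, Finset.mem_filter, Finset.mem_filter]
    by_contra hcon
    push Not at hcon
    obtain ⟨t, -, ht⟩ := hcon.1 hD.1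
    have hDB : ∀ w, (D w : ℝ) ≤ B := by
      intro w
      have h1 : D w ≤ ⌊B⌋₊ := Nat.lt_add_one_iff.1 (hcon.2 hD.1 w)
      exact (Nat.cast_le.2 h1).trans (Nat.floor_le hB0)
    have h1 := weight_lt_one_of_le_cutoff hℓ2 (v t) hθ hlam0 (hθA (v t)) hB0 hfar ht hDB
    have h2 := one_le_weight_of_solvableAt hq (hD.2 (v t))
    linarith
  have hle := (Finset.card_le_card hsub).trans (Finset.card_union_le _ _)
  have hle' : (((configs d n k).filter (fun D => Solvable q D)).card : ℝ) ≤
      ((configs d n k).filter (fun D => ∀ t ∈ Finset.range τ, ¬ Ev t D)).card +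
        ((configs d n k).filter (fun D => ∃ w, r ≤ D w)).card := by exact_mod_cast hle
  rw [add_mul]
  exact hle'.trans (add_le_add hsm htail)

/-- At the scale of the threshold, a point of an edge sees two orthants of main term
`log n / 2` each, and enlarging the cutoffs by `exp K` compensates the lower order terms. -/
lemma le_card_cutoff_edgePoint {ℓ : Fin d → ℝ} (hℓ : ∀ i, 0 < ℓ i) (hn : 0 < n) (a : ℕ)
    {k : ℕ} {K θ lam R : ℝ} (hKs : 0 ≤ K - ∑ i, ℓ i) (hLK : K ≤ radius ℓ n)
    (hγK : simplexConst ℓ * (K - ∑ i, ℓ i) = 6 * 17 ^ d + 1)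
    (hlam : lam = (k : ℝ) / (n : ℝ) ^ d) (hlam4 : 4 ≤ lam)
    (hM : lam ≤ θ * Real.exp (radius ℓ n - K)) (hL1 : 1 ≤ radius ℓ n)
    (hN : ((gridBall ℓ (edgePoint d hn a) R).card : ℝ) ≤ 17 ^ d * radius ℓ n ^ d)
    (hNm : 4 * ((gridBall ℓ (edgePoint d hn a) R).card : ℝ) ≤ (n : ℝ) ^ d)
    (hNlam : ((gridBall ℓ (edgePoint d hn a) R).card : ℝ) * lam ≤ (n : ℝ) ^ d) (hd : 1 ≤ d) :
    Real.exp (radius ℓ n) / n * (configs d n k).card ≤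
      ((configs d n k).filter fun D => ∀ w ∈ gridBall ℓ (edgePoint d hn a) R,
        D w ≤ cutoff ℓ (edgePoint d hn a) θ lam w).card := by
  have hn0 : (0 : ℝ) < n := by exact_mod_cast hn
  have hs0 : 0 ≤ ∑ i, ℓ i := Finset.sum_nonneg fun i _ => (hℓ i).le
  have hlogn := simplexConst_mul_radius_pow hℓ n
  have hγ0 : 0 < simplexConst ℓ := simplexConst_pos hℓ
  refine le_trans ?_ (le_card_cutoff (M := radius ℓ n - K) (edgePoint d hn a) rfl hn hlam hlam4 hM
    hNm hNlam)
  refine mul_le_mul_of_nonneg_right ?_ (Nat.cast_nonneg _)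
  have h1 := sum_truncPow_le hℓ (edgePoint d hn a) one_ne_zero (radius ℓ n - K)
  have hconst : ((1 : ℕ).factorial : ℝ) / ((1 + d).factorial * ∏ i, ℓ i) = simplexConst ℓ / 2 := by
    rw [simplexConst, add_comm 1 d, Nat.factorial_one, Nat.cast_one]
    ring
  rw [hconst, add_comm 1 d] at h1
  set L := radius ℓ n
  set s := ∑ i, ℓ i
  set γ := simplexConst ℓ
  have hLd : L ≤ L ^ d := by
    calc L = L ^ 1 := (pow_one L).symm
      _ ≤ L ^ d := pow_le_pow_right₀ hL1 hd
  have h2 : truncPow (d + 1) (L - K + s) ≤ L ^ (d + 1) - (K - s) * L ^ d := by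
    rw [show L - K + s = L - (K - s) by ring, truncPow_of_nonneg _ (by linarith)]
    exact sub_pow_succ_le hKs (by linarith) d
  have h3 : ∑ w, truncPow 1 (L - K - gridDist ℓ (edgePoint d hn a) w) ≤
      γ * (L ^ (d + 1) - (K - s) * L ^ d) := by
    refine h1.trans ?_
    calc _ ≤ (2 * (γ / 2)) * (L ^ (d + 1) - (K - s) * L ^ d) := by
          refine mul_le_mul (mul_le_mul_of_nonneg_right
            (prod_sidesUpper_edgePoint_le _ a) (by positivity)) h2
            (truncPow_nonneg _ _) (by positivity)
      _ = _ := by ring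
  have h4 : γ * (L ^ (d + 1) - (K - s) * L ^ d) = Real.log n - (6 * 17 ^ d + 1) * L ^ d := by
    rw [← hlogn, ← hγK]
    ring
  rw [h4] at h3
  rw [← Real.exp_log hn0, ← Real.exp_sub]
  refine Real.exp_le_exp.2 ?_
  linarith

set_option maxHeartbeats 1000000 in
/-- With a small multiple of `n ^ d * density d L` pebbles, where `L` is the radius, some point
of an edge of the grid is unsolvable with high probability: such a point is surrounded by two
orthants up to lower order terms, so it is unsolvable with probability at least about `1 / n`. -/
theorem exists_solvableProb_le (hd : 1 ≤ d) {q : Fin d → ℕ} (hq : ∀ i, 2 ≤ q i) :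
    ∃ c : ℝ, 0 < c ∧ ∀ ε : ℝ, 0 < ε → ∀ᶠ n : ℕ in atTop, ∀ k : ℕ,
      (k : ℝ) ≤ c * ((n : ℝ) ^ d * density d (radius (logs q) n)) → solvableProb q n k ≤ ε := by
  set ℓ := logs q
  have hℓ : ∀ i, 0 < ℓ i := logs_pos hq
  have hℓ2 : ∀ i, Real.log 2 ≤ ℓ i := log_two_le_logs hq
  set γ := simplexConst ℓ with hγ
  have hγ0 : 0 < γ := simplexConst_pos hℓ
  set s := ∑ i, ℓ i
  have hs0 : 0 ≤ s := Finset.sum_nonneg fun i _ => (hℓ i).le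
  -- this choice makes the gain from shrinking the radius by `K` exceed all lower order terms
  set K := s + (6 * 17 ^ d + 1) / γ with hK
  have hKs : 0 ≤ K - s := by rw [hK]; ring_nf; positivity
  have hγK : γ * (K - s) = 6 * 17 ^ d + 1 := by
    rw [hK]
    field_simp
    ring
  set θ₀ : ℝ := 1 / (2 * 17 ^ d) with hθ₀
  set c := θ₀ * Real.exp (-K) with hc
  have hc0 : 0 < c := by positivity
  have hc1 : c ≤ 1 := by
    have h1 : θ₀ ≤ 1 := by
      rw [hθ₀, div_le_one (by positivity)]
      have : (1 : ℝ) ≤ 17 ^ d := one_le_pow₀ (by norm_num)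
      linarith
    have h2 : Real.exp (-K) ≤ 1 := Real.exp_le_one_iff.2 (by linarith)
    calc c ≤ 1 * 1 := mul_le_mul h1 h2 (Real.exp_pos _).le zero_le_one
      _ = 1 := one_mul 1
  refine ⟨c, hc0, fun ε hε => ?_⟩
  have hrad := tendsto_radius hℓ
  have E1 := hrad.eventually (eventually_ge_atTop (max (max 1 K) (6 / γ)))
  have E2 := hrad.eventually (eventually_mul_pow_le_exp (4 * 17 ^ d) d one_pos)
  have E3 := hrad.eventually (eventually_mul_pow_le_exp (8 / c) d one_pos)
  have E4 := hrad.eventually (eventually_mul_pow_le_exp (3 * 8 ^ (d + 1) * d * γ) 1 one_pos)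
  have E5 := hrad.eventually (eventually_mul_pow_le_exp (89 / ε) 1 one_pos)
  have E6 := hrad.eventually (eventually_mul_pow_le_exp 36 1 one_pos)
  filter_upwards [E1, E2, E3, E4, E5, E6, eventually_ge_atTop 2] with n e1 e2 e3 e4 e5 e6 hn k hk
  have hexp := exp_simplexConst_mul_radius_pow hℓ (show 1 ≤ n by omega)
  have hlogn := simplexConst_mul_radius_pow hℓ n
  set L := radius ℓ n
  rw [← hγ] at hexp hlogn
  have hL1 : 1 ≤ L := (le_max_left _ _).trans ((le_max_left _ _).trans e1)
  have hLK : K ≤ L := (le_max_right _ _).trans ((le_max_left _ _).trans e1)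
  have hL6 : 6 ≤ γ * L := by
    have := (le_max_right _ _).trans e1
    rw [div_le_iff₀ hγ0] at this
    linarith
  have hL0 : 0 < L := by linarith
  have hLd : L ≤ L ^ d := by
    calc L = L ^ 1 := (pow_one L).symm
      _ ≤ L ^ d := pow_le_pow_right₀ hL1 hd
  rw [one_mul] at e2 e3 e4 e5 e6
  rw [pow_one] at e4 e5 e6
  have hnm : (n : ℝ) ≤ (n : ℝ) ^ d := by
    calc (n : ℝ) = (n : ℝ) ^ 1 := (pow_one _).symm
      _ ≤ (n : ℝ) ^ d := pow_le_pow_right₀ (by exact_mod_cast (show 1 ≤ n by omega)) hd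
  set m : ℝ := (n : ℝ) ^ d with hm
  have hm0 : 0 < m := by positivity
  have hn6 : Real.exp (6 * L) ≤ n := by
    rw [← hexp]
    refine Real.exp_le_exp.2 ?_
    calc 6 * L ≤ (γ * L) * L ^ d := mul_le_mul hL6 hLd hL0.le (by positivity)
      _ = γ * L ^ (d + 1) := by ring
  set x := c * (m * density d L) with hx
  have hg : 8 ≤ c * density d L := by
    rw [density, mul_div_assoc', le_div_iff₀ (by positivity)]
    rw [div_mul_eq_mul_div, div_le_iff₀ hc0] at e3
    linarith
  have hx8 : 8 * m ≤ x := by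
    rw [hx]
    nlinarith
  have hm1 : 1 ≤ m := by
    have : (1 : ℝ) ≤ n := by exact_mod_cast (show 1 ≤ n by omega)
    linarith
  set k₀ := ⌊x⌋₊ with hk₀
  have hkk₀ : k ≤ k₀ := Nat.le_floor hk
  have hk₀le : (k₀ : ℝ) ≤ x := Nat.floor_le (by linarith)
  have hk₀ge : 4 * m ≤ k₀ := by
    have := Nat.lt_floor_add_one x
    rw [← hk₀] at this
    linarith
  set lam : ℝ := (k₀ : ℝ) / m with hlam
  have hlam4 : 4 ≤ lam := by
    rw [hlam, le_div_iff₀ hm0]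
    exact hk₀ge
  have hlam0 : 0 < lam := by linarith
  have hlamle : lam ≤ c * density d L := by
    rw [hlam, div_le_iff₀ hm0]
    calc (k₀ : ℝ) ≤ x := hk₀le
      _ = _ := by rw [hx]; ring
  have hlamexp : lam * L ^ d ≤ Real.exp L := by
    calc lam * L ^ d ≤ (c * density d L) * L ^ d :=
          mul_le_mul_of_nonneg_right hlamle (by positivity)
      _ = c * Real.exp L := by rw [density]; field_simp
      _ ≤ 1 * Real.exp L := mul_le_mul_of_nonneg_right hc1 (Real.exp_pos _).le
      _ = _ := one_mul _
  set θ := θ₀ / L ^ d with hθ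
  have hcard : ∀ v : Grid d n, ((gridBall ℓ v (4 * L)).card : ℝ) ≤ 17 ^ d * L ^ d := by
    intro v
    refine (card_gridBall_le hℓ2 v (by positivity)).trans ?_
    rw [← mul_pow]
    exact pow_le_pow_left₀ (by positivity) (by linarith) d
  have hball4 : ∀ v : Grid d n, 4 * ((gridBall ℓ v (4 * L)).card : ℝ) ≤ Real.exp L := fun v => by
    linarith [hcard v]
  have h17 : (17 : ℝ) ^ d ≤ Real.exp L := by
    have : (1 : ℝ) ≤ L ^ d := hL1.trans hLd
    have h2 : (0 : ℝ) < 17 ^ d := by positivity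
    nlinarith
  have hballlam : ∀ v : Grid d n, ((gridBall ℓ v (4 * L)).card : ℝ) * lam ≤ Real.exp (2 * L) := by
    intro v
    calc _ ≤ (17 ^ d * L ^ d) * lam := mul_le_mul_of_nonneg_right (hcard v) hlam0.le
      _ = 17 ^ d * (lam * L ^ d) := by ring
      _ ≤ Real.exp L * Real.exp L := mul_le_mul h17 hlamexp (by positivity) (Real.exp_pos _).le
      _ = _ := by rw [← Real.exp_add]; congr 1; ring
  have hexp16 : Real.exp L ≤ Real.exp (2 * L) := Real.exp_le_exp.2 (by linarith)
  have hexp26 : Real.exp (2 * L) ≤ m :=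
    (Real.exp_le_exp.2 (by linarith : 2 * L ≤ 6 * L)).trans (hn6.trans hnm)
  -- the spacing and the number of the points
  set sp := ⌈16 * L⌉₊ + 1 with hsp
  have hsp1 : 16 * L < sp := by
    rw [hsp]
    push_cast
    linarith [Nat.le_ceil (16 * L)]
  have hsp2 : (sp : ℝ) ≤ 18 * L := by
    rw [hsp]
    push_cast
    linarith [Nat.ceil_lt_add_one (show 0 ≤ 16 * L by positivity)]
  have hsp0 : (0 : ℝ) < sp := by linarith
  set τ := n / sp
  have hτ1 : (n : ℝ) / (36 * L) ≤ τ := by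
    have h1 : n < sp * (τ + 1) := Nat.lt_mul_div_succ n (by exact_mod_cast hsp0)
    have h2 : (n : ℝ) < sp * (τ + 1) := by exact_mod_cast h1
    have h3 : 36 * L ≤ n :=
      e6.trans ((Real.exp_le_exp.2 (by linarith : L ≤ 6 * L)).trans hn6)
    rw [div_le_iff₀ (by positivity)]
    have h4 : (sp : ℝ) * (τ + 1) ≤ 18 * L * (τ + 1) :=
      mul_le_mul_of_nonneg_right hsp2 (by positivity)
    linarith
  set S := ⌈2 * Real.exp (2 * L)⌉₊
  have hsingle : ∀ a, Real.exp L / n * (configs d n k₀).card ≤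
      ((configs d n k₀).filter fun D => ∀ w ∈ gridBall ℓ (edgePoint d (by omega : 0 < n) a) (4 * L),
        D w ≤ cutoff ℓ (edgePoint d (by omega : 0 < n) a) θ lam w).card := by
    intro a
    exact le_card_cutoff_edgePoint hℓ (by omega) a hKs hLK hγK hlam hlam4
      (hlamle.trans (le_of_eq (by
        rw [hθ, hc, density, Real.exp_sub, Real.exp_neg]
        ring))) hL1 (hcard _) ((hball4 _).trans (hexp16.trans hexp26))
      ((hballlam _).trans hexp26) hd
  have hηb : 2 * (S : ℝ) ^ 2 / (n ^ d + k₀ - 1 : ℕ) ≤ 8 * Real.exp (-L) := by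
    have h1 : m ≤ ((n ^ d + k₀ - 1 : ℕ) : ℝ) := by
      have : 1 ≤ k₀ := by
        have : (1 : ℝ) ≤ k₀ := by linarith
        exact_mod_cast this
      have h2 : n ^ d ≤ n ^ d + k₀ - 1 := by omega
      rw [hm]
      exact_mod_cast h2
    have h2 : (S : ℝ) ≤ 3 * Real.exp (2 * L) := by
      have h3 := (Nat.ceil_lt_add_one (show 0 ≤ 2 * Real.exp (2 * L) by positivity)).le
      have h4 : 1 ≤ Real.exp (2 * L) := Real.one_le_exp (by positivity)
      linarith
    rw [div_le_iff₀ (by linarith)]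
    have h3 : Real.exp (6 * L) ≤ ((n ^ d + k₀ - 1 : ℕ) : ℝ) := (hn6.trans hnm).trans h1
    calc 2 * (S : ℝ) ^ 2 ≤ 2 * (3 * Real.exp (2 * L)) ^ 2 := by gcongr
      _ = 18 * Real.exp (4 * L) := by
          rw [mul_pow, ← Real.exp_nat_mul]
          push_cast
          ring_nf
      _ ≤ 8 * Real.exp L * Real.exp (4 * L) := by
          have h36 : 36 ≤ Real.exp L := by linarith
          have := Real.exp_pos (4 * L)
          nlinarith
      _ = 8 * Real.exp (5 * L) := by
          rw [mul_assoc, ← Real.exp_add]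
          congr 2
          ring
      _ = 8 * Real.exp (-L) * Real.exp (6 * L) := by
          rw [mul_assoc, ← Real.exp_add]
          congr 2
          ring
      _ ≤ _ := by gcongr
  have hexpinv : Real.exp (-L) * Real.exp L = 1 := by rw [← Real.exp_add]; simp
  have hηhalf : 8 * Real.exp (-L) ≤ 1 / 2 := by
    have := Real.exp_pos (-L)
    nlinarith
  have hmain := card_solvable_le hq hd hn (k := k₀) (s := sp) (τ := τ) (θ := θ) (lam := lam)
    (R := 4 * L) (P := Real.exp L / n) (η := 8 * Real.exp (-L)) (E := Real.exp L / (36 * L))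
    (S := S) (by
      have : m ≤ k₀ := by linarith
      rw [hm] at this
      exact_mod_cast this) hlam (by positivity) (by positivity) (by linarith)
    (Nat.div_mul_le_self n sp)
    (fun v => by
      have h1 := hcard v
      calc θ * ((gridBall ℓ v (4 * L)).card : ℝ) ≤ θ * (17 ^ d * L ^ d) :=
            mul_le_mul_of_nonneg_left h1 (by positivity)
        _ = 1 / 2 := by
            rw [hθ, hθ₀]
            field_simp)
    (by
      have h1 : Real.log ((n : ℝ) ^ d) = d * (γ * L ^ (d + 1)) := by rw [Real.log_pow, hlogn]
      rw [h1]
      have e : Real.exp (-(4 * L / 2)) = Real.exp (-L) * Real.exp (-L) := by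
        rw [← Real.exp_add]
        congr 1
        ring
      rw [e]
      calc _ = 8 ^ (d + 1) * d * γ * L * (lam * L ^ d) * (Real.exp (-L) * Real.exp (-L)) := by ring
        _ ≤ 8 ^ (d + 1) * d * γ * L * Real.exp L * (Real.exp (-L) * Real.exp (-L)) := by gcongr
        _ = 8 ^ (d + 1) * d * γ * L * Real.exp (-L) := by
            linear_combination (8 ^ (d + 1) * d * γ * L * Real.exp (-L)) * hexpinv
        _ ≤ (Real.exp L / 3) * Real.exp (-L) :=
            mul_le_mul_of_nonneg_right (by linarith) (Real.exp_pos _).le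
        _ = 1 / 3 := by linear_combination hexpinv / 3
        _ < 1 / 2 := by norm_num)
    (fun v => (hball4 v).trans (hexp16.trans hexp26))
    (fun v => by
      have h1 : ((gridBall ℓ v (4 * L)).card : ℝ) + (gridBall ℓ v (4 * L)).card * lam ≤
          2 * Real.exp (2 * L) := by
        have := hball4 v
        have := hballlam v
        have := Real.exp_pos L
        linarith
      exact h1.trans (Nat.le_ceil _))
    hηb hηhalf (by positivity) (by
      calc Real.exp L / (36 * L) = n / (36 * L) * (Real.exp L / n) := by field_simp
        _ ≤ _ := mul_le_mul_of_nonneg_right hτ1 (by positivity)) hsingle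
  refine (solvableProb_mono (by omega) hkk₀).trans (hmain.trans ?_)
  have hinv : ((n : ℝ) ^ d)⁻¹ ≤ Real.exp (-L) := by
    rw [Real.exp_neg]
    exact inv_anti₀ (Real.exp_pos _) (hexp16.trans hexp26)
  have h1 : 1 / (Real.exp L / (36 * L)) = 36 * L * Real.exp (-L) := by
    rw [one_div_div, Real.exp_neg, div_eq_mul_inv]
  rw [h1]
  have h2 : 89 * L * Real.exp (-L) ≤ ε := by
    rw [div_mul_eq_mul_div, div_le_iff₀ hε] at e5
    calc _ ≤ (Real.exp L * ε) * Real.exp (-L) := mul_le_mul_of_nonneg_right e5 (Real.exp_pos _).le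
      _ = ε := by linear_combination ε * hexpinv
  have h3 := Real.exp_pos (-L)
  have h4 : Real.exp (-L) ≤ L * Real.exp (-L) := le_mul_of_one_le_left h3.le hL1
  linarith

end LowerBound

end Pebbling

/-! ### The threshold -/

namespace Pebbling

section Threshold

variable {d : ℕ}

lemma half_le_solvableProb_halfThreshold (hd : 1 ≤ d) (q : Fin d → ℕ) {n : ℕ} (hn : 2 ≤ n) :
    1 / 2 ≤ solvableProb q n (halfThreshold q n) := by
  refine Nat.sInf_mem (s := {k : ℕ | (1 / 2 : ℝ) ≤ solvableProb q n k})
    ⟨2 * n ^ d * n ^ d, le_trans ?_ (one_sub_div_le_solvableProb hd hn _)⟩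
  have h : (0 : ℝ) < (n : ℝ) ^ d := by positivity
  have h1 : (n : ℝ) ^ d * ((n : ℝ) ^ d / ((n : ℝ) ^ d + (2 * n ^ d * n ^ d : ℕ))) ≤ 1 / 2 := by
    rw [← mul_div_assoc, div_le_div_iff₀ (by positivity) two_pos]
    push_cast
    nlinarith
  linarith

lemma halfThreshold_pos (hd : 1 ≤ d) {q : Fin d → ℕ} (hq : ∀ i, 2 ≤ q i) {n : ℕ} (hn : 2 ≤ n) :
    0 < halfThreshold q n := by
  refine Nat.pos_of_ne_zero fun h => ?_
  have h1 := half_le_solvableProb_halfThreshold hd q hn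
  rw [h, solvableProb_zero (by omega) hq] at h1
  norm_num at h1

/-- The exponential of the formula for the threshold differs from the density by a constant
factor, as `log (radius ℓ n) = (log (log n) - log (simplexConst ℓ)) / (d + 1)`. -/
lemma log_density_radius {ℓ : Fin d → ℝ} (hℓ : ∀ i, 0 < ℓ i) {n : ℕ} (hL : 0 < radius ℓ n) :
    Real.log (density d (radius ℓ n)) = radius ℓ n -
      (d : ℝ) * Real.log (Real.log n) / ((d : ℝ) + 1) +
      d * Real.log (simplexConst ℓ) / ((d : ℝ) + 1) := by
  have h : Real.log (Real.log n) =
      Real.log (simplexConst ℓ) + ((d : ℝ) + 1) * Real.log (radius ℓ n) := by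
    rw [← simplexConst_mul_radius_pow hℓ, Real.log_mul (simplexConst_pos hℓ).ne' (by positivity),
      Real.log_pow]
    push_cast
    rfl
  have h1 : (d : ℝ) + 1 ≠ 0 := by positivity
  rw [density, Real.log_div (Real.exp_pos _).ne' (by positivity), Real.log_exp, Real.log_pow, h]
  field_simp
  ring

lemma exists_halfThreshold_bounds (hd : 1 ≤ d) {q : Fin d → ℕ} (hq : ∀ i, 2 ≤ q i) :
    ∃ c C : ℝ, 0 < c ∧ 0 < C ∧ ∀ᶠ n : ℕ in atTop,
      c * ((n : ℝ) ^ d * density d (radius (logs q) n)) ≤ halfThreshold q n ∧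
      (halfThreshold q n : ℝ) ≤ C * ((n : ℝ) ^ d * density d (radius (logs q) n)) := by
  obtain ⟨c, hc, hlow⟩ := exists_solvableProb_le hd hq
  obtain ⟨C, hC, hup⟩ := exists_solvableProb_ge hd hq
  refine ⟨c, C + 1, hc, by positivity, ?_⟩
  have hdens := (tendsto_radius (logs_pos hq)).eventually
    ((eventually_mul_pow_le_exp 1 d one_pos).and (eventually_gt_atTop 0))
  filter_upwards [hlow (1 / 4) (by norm_num), hup (1 / 2) (by norm_num), hdens,
    eventually_ge_atTop 2] with n h1 h2 h3 hn
  set g := (n : ℝ) ^ d * density d (radius (logs q) n) with hg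
  have hg1 : 1 ≤ g := by
    refine one_le_mul_of_one_le_of_one_le (one_le_pow₀ (by exact_mod_cast (by omega : 1 ≤ n))) ?_
    rw [density, one_le_div (pow_pos h3.2 d)]
    simpa using h3.1
  constructor
  · by_contra! hlt
    have := h1 _ hlt.le
    linarith [half_le_solvableProb_halfThreshold hd q hn]
  · have h4 : halfThreshold q n ≤ ⌈C * g⌉₊ := by
      refine Nat.sInf_le ?_
      have := h2 ⌈C * g⌉₊ (Nat.le_ceil _)
      norm_num at this
      simpa using this
    have h5 : (halfThreshold q n : ℝ) ≤ ⌈C * g⌉₊ := by exact_mod_cast h4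
    linarith [Nat.ceil_lt_add_one (show 0 ≤ C * g by positivity)]

lemma isWeakThreshold_halfThreshold (hd : 1 ≤ d) {q : Fin d → ℕ} (hq : ∀ i, 2 ≤ q i) :
    IsWeakThreshold q fun n => (halfThreshold q n : ℝ) := by
  obtain ⟨c, hc, hlow⟩ := exists_solvableProb_le hd hq
  obtain ⟨C, hC, hup⟩ := exists_solvableProb_ge hd hq
  obtain ⟨c', C', hc', hC', hP⟩ := exists_halfThreshold_bounds hd hq
  refine fun k => ⟨fun hk => ?_, fun hk => ?_⟩
  · rw [Metric.tendsto_nhds]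
    intro ε hε
    filter_upwards [hlow (ε / 2) (by positivity), hP, hk.bound (show 0 < c / C' by positivity)]
      with n h1 h2 h3
    simp only [Real.norm_natCast] at h3
    have h4 : (k n : ℝ) ≤ c * ((n : ℝ) ^ d * density d (radius (logs q) n)) := by
      refine h3.trans ((mul_le_mul_of_nonneg_left h2.2 (by positivity)).trans_eq ?_)
      field_simp
    rw [Real.dist_eq, sub_zero, abs_of_nonneg (solvableProb_nonneg q n _)]
    linarith [h1 _ h4]
  · rw [Metric.tendsto_nhds]
    intro ε hε
    filter_upwards [hup (ε / 2) (by positivity), hP, hk.bound (show 0 < c' / C by positivity)]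
      with n h1 h2 h3
    simp only [Real.norm_natCast] at h3
    have h4 : C * ((n : ℝ) ^ d * density d (radius (logs q) n)) ≤ k n := by
      have h5 := h2.1.trans h3
      rw [div_mul_eq_mul_div, le_div_iff₀ hC] at h5
      refine le_of_mul_le_mul_left ?_ hc'
      linarith
    rw [Real.dist_eq, abs_sub_comm, abs_of_nonneg (sub_nonneg.2 (solvableProb_le_one q n _))]
    linarith [h1 _ h4]

end Threshold

end Pebbling

theorem theorem1 (d : ℕ) (hd : 1 ≤ d) (q : Fin d → ℕ) (hq : ∀ i, 2 ≤ q i) :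
    (∃ E : ℕ → ℝ, E =O[atTop] (fun _ => (1 : ℝ)) ∧
      ∀ n : ℕ, 2 ≤ n →
        (Pebbling.halfThreshold q n : ℝ) =
          (n : ℝ) ^ d * Real.exp
            (((Nat.factorial (d + 1) : ℝ) * Real.log (n : ℝ) *
                (∏ i, Real.log (q i : ℝ)) / 2) ^ ((1 : ℝ) / ((d : ℝ) + 1))
              - (d : ℝ) * Real.log (Real.log (n : ℝ)) / ((d : ℝ) + 1) + E n)) ∧
    Pebbling.IsWeakThreshold q (fun n => (Pebbling.halfThreshold q n : ℝ)) := by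
  refine ⟨⟨fun n => Real.log (Pebbling.halfThreshold q n / (n : ℝ) ^ d) -
    (Pebbling.radius (Pebbling.logs q) n -
      (d : ℝ) * Real.log (Real.log (n : ℝ)) / ((d : ℝ) + 1)), ?_, ?_⟩,
    Pebbling.isWeakThreshold_halfThreshold hd hq⟩
  · have hℓ := Pebbling.logs_pos hq
    obtain ⟨c, C, hc, hC, hP⟩ := Pebbling.exists_halfThreshold_bounds hd hq
    set K := (d : ℝ) * Real.log (Pebbling.simplexConst (Pebbling.logs q)) / ((d : ℝ) + 1) with hK
    refine IsBigO.of_bound (|Real.log c| + |Real.log C| + |K|) ?_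
    filter_upwards [hP, (Pebbling.tendsto_radius hℓ).eventually_gt_atTop 0,
      eventually_ge_atTop 2] with n h1 hL hn
    have hnd : (0 : ℝ) < (n : ℝ) ^ d := by
      have : 0 < n := by omega
      positivity
    have hD : 0 < Pebbling.density d (Pebbling.radius (Pebbling.logs q) n) := by
      rw [Pebbling.density]
      positivity
    have hlog := Pebbling.log_density_radius hℓ hL
    rw [← hK] at hlog
    have hlo : c * Pebbling.density d (Pebbling.radius (Pebbling.logs q) n) ≤
        Pebbling.halfThreshold q n / (n : ℝ) ^ d := by
      rw [le_div_iff₀ hnd]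
      linarith [h1.1]
    have hup : Pebbling.halfThreshold q n / (n : ℝ) ^ d ≤
        C * Pebbling.density d (Pebbling.radius (Pebbling.logs q) n) := by
      rw [div_le_iff₀ hnd]
      linarith [h1.2]
    have hlo' := Real.log_le_log (by positivity) hlo
    have hup' := Real.log_le_log ((mul_pos hc hD).trans_le hlo) hup
    rw [Real.log_mul hc.ne' hD.ne', hlog] at hlo'
    rw [Real.log_mul hC.ne' hD.ne', hlog] at hup'
    rw [norm_one, mul_one, Real.norm_eq_abs, abs_le]
    constructor <;> linarith [neg_abs_le (Real.log c), le_abs_self (Real.log C), neg_abs_le K,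
      le_abs_self K, abs_nonneg (Real.log c), abs_nonneg (Real.log C), abs_nonneg K]
  · intro n hn
    have hnd : (0 : ℝ) < (n : ℝ) ^ d := by
      have : 0 < n := by omega
      positivity
    have hP : (0 : ℝ) < Pebbling.halfThreshold q n := by
      exact_mod_cast Pebbling.halfThreshold_pos hd hq hn
    -- the exponent in the statement is `radius (logs q) n` by definition
    change (Pebbling.halfThreshold q n : ℝ) = (n : ℝ) ^ d * Real.exp
      (Pebbling.radius (Pebbling.logs q) n - (d : ℝ) * Real.log (Real.log (n : ℝ)) / ((d : ℝ) + 1) +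
        (Real.log (Pebbling.halfThreshold q n / (n : ℝ) ^ d) -
          (Pebbling.radius (Pebbling.logs q) n -
            (d : ℝ) * Real.log (Real.log (n : ℝ)) / ((d : ℝ) + 1))))
    rw [add_sub_cancel, Real.exp_log (by positivity), mul_div_cancel₀ _ hnd.ne']
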